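/- **Setting.** Let $V$ be a finite set of offline vertices and let $d\ge 1$. Online vertices $j=1,\dots,n$ arrive one at a time ($n$ is not known in advance); on arrival $j$ reveals its set of neighbours $N(j)\subseteq V$ and is irrevocably matched to one available neighbour or left unmatched. An offline vertex matched at time $j'$ is unavailable at the times $j'+1,\dots,j'+d-1$ and available again from time $j'+d$ on. A randomized online algorithm that always produces such an integral matching is $\Gamma$-competitive if, on every instance, the expected number of matched online vertices is at least $\Gamma$ times the maximum number that can be matched offline, knowing the whole graph. **OCR.** An inner algorithm receives online a sequence of proposals $Q_1,Q_2,\dots\subseteq V$ with $|Q_j|\le 2$ and selects, with randomization, an element of each nonempty $Q_j$ on arrival; a selected vertex is matched if it is available. Let $\Delta\mu^i_j$ be the probability that $i$ is matched in round $j$, let $p^i_j=1-\sum_{t=j-d+1}^{j-1}\Delta\mu^i_t$ (the probability that $i$ is available at time $j$), and let $\mathrm{prev}^i_j$ be the last round before $j$ in which $i$ was proposed ($-\infty$ if none). Put $u^i_j=p^i_{j'}-\Delta\mu^i_{j'}$ if $j'=\mathrm{prev}^i_j>j-d$ and $u^i_j=0$ otherwise, and $r^i_j=p^i_j-u^i_j$.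 For $c\in\{1,2\}$ let $g^i_j(c)=p^i_j$ if $c=1$ and $g^i_j(c)=p^i_j/2+\gamma u^i_j$ if $c=2$. The inner algorithm is a $\gamma$-OCR if, for all proposal sequences, $\Delta\mu^i_j\ge g^i_j(|Q_j|)$ for all $j$ and all $i\in Q_j$. **Inner algorithm $\mathcal A$.** It keeps state variables $\tau_{i,t}\in\{\text{unknown},\text{selected},\text{not-selected}\}$, initially unknown. For $Q_j=\{i_1\}$: set $\tau_{i_1,[j+1,j+d-1]}$ to unknown and select $i_1$. For $Q_j=\{i_1,i_2\}$: with probability $1/2$ the round is a sender, and otherwise a receiver. Sender: draw $\ell,m\in\{1,2\}$ independently and uniformly, set $\tau_{i_{3-m},[j+1,j+d-1]}$ to unknown and $\tau_{i_m,[j+1,j+d-1]}$ to selected if $m=\ell$ and to not-selected otherwise. Receiver: draw $m\in\{1,2\}$ uniformly; put $\ell=3-m$ if $\tau_{i_m,j}$ is selected, $\ell=m$ if it is not-selected, and draw $\ell\in\{1,2\}$ uniformly if it is unknown; then set $\tau_{i_1,[j+1,j+d-1]}$ and $\tau_{i_2,[j+1,j+d-1]}$ to unknown. In both cases select $i_\ell$.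 **Primal-dual algorithm over a $\gamma$-OCR, with parameters $\beta_1,\beta_2$.** When $j$ arrives, propose to the OCR a set $Q_j\subseteq N(j)$ with $|Q_j|\le 2$ that maximizes $$\beta_j(Q)=\sum_{i\in Q}\Big(\beta_1\,\frac{r^i_j}{2}+\beta_2\Big(g^i_j(|Q|)-\frac{r^i_j}{2}\Big)\Big)$$ over all such sets $Q$ (ties are broken arbitrarily; $p,u,r$ refer to the given OCR on the proposals $Q_1,\dots,Q_{j-1}$), and match $j$ to the vertex selected by the OCR if that vertex is available. **Theorem.** Let $\gamma=\frac1{32}$, $\beta_1=\frac{3+4\gamma}{6+6\gamma}=\frac{50}{99}$ and $\beta_2=\frac1{2+2\gamma}$. (1) $\mathcal A$ is a $\gamma$-OCR. (2) For every $\gamma$-OCR and every tie-breaking rule, the primal-dual algorithm with parameters $\beta_1,\beta_2$ run on this OCR is $\frac{50}{99}$-competitive. (3) In particular, the primal-dual algorithm run on $\mathcal A$ is a randomized integral online algorithm that is $\frac{50}{99}$-competitive ($\frac{50}{99}\approx 0.505$). -/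

import Mathlib

open scoped ENNReal

universe u

namespace ReusableMatching

/-! ### The problem

The offline side is a type `V`.  Online vertices arrive at times `0, 1, …, n - 1`, and `N j` is the
set of offline neighbours of the online vertex arriving at time `j`.  A (partial) assignment is a
function `M : ℕ → Option V`, where `M j = some i` says that the online vertex `j` is matched to
`i`. -/

section Problem

variable {V : Type u}

/-- Offline vertex `i` is available at time `j`: it has not been matched at any of the times
`j - d + 1, …, j - 1`. -/
def Available (d : ℕ) (M : ℕ → Option V) (i : V) (j : ℕ) : Prop :=
  ∀ t < j, M t = some i → t + d ≤ j

/-- `M` is a feasible matching of the first `n` online vertices: every online vertex is matched to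
at most one neighbour, which is available at that time. -/
def IsFeasible (d : ℕ) (N : ℕ → Finset V) (n : ℕ) (M : ℕ → Option V) : Prop :=
  ∀ j < n, ∀ i, M j = some i → i ∈ N j ∧ Available d M i j

/-- The number of matched online vertices among the first `n`. -/
def size (n : ℕ) (M : ℕ → Option V) : ℕ :=
  ((Finset.range n).filter fun j => (M j).isSome = true).card

/-- The size of an optimal offline matching. -/
noncomputable def opt (d : ℕ) (N : ℕ → Finset V) (n : ℕ) : ℕ :=
  sSup {k | ∃ M, IsFeasible d N n M ∧ size n M = k}

/-- The supremum defining `opt` is attained. -/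
theorem opt_isGreatest (d : ℕ) (N : ℕ → Finset V) (n : ℕ) :
    IsGreatest {k | ∃ M, IsFeasible d N n M ∧ size n M = k} (opt d N n) := by
  have hb : BddAbove {k | ∃ M, IsFeasible d N n M ∧ size n M = k} := by
    refine ⟨n, ?_⟩
    rintro k ⟨M, -, rfl⟩
    exact (Finset.card_filter_le _ _).trans (Finset.card_range n).le
  refine ⟨Nat.sSup_mem ⟨size n (fun _ => none), fun _ => none, ?_, rfl⟩ hb, ?_⟩
  · intro j _ i h
    cases h
  · intro k hk
    exact le_csSup hb hk

end Problem

/-! ### Randomized online procedures -/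

/-- A randomized online procedure with private memory: in every round it receives a finite set of
offline vertices and irrevocably outputs an offline vertex or nothing.  Both online matching
algorithms (which receive the set of neighbours of the arriving online vertex) and inner selection
algorithms (which receive a proposed set) are of this form. -/
structure OnlineProcedure (V : Type u) where
  State : Type u
  init : State
  step : State → Finset V → PMF (Option V × State)

namespace OnlineProcedure

variable {V : Type u}

/-- The joint law of the first `n` outputs and of the memory after `n` rounds on the input
`N 0, N 1, …`.  Outputs at times `≥ n` are recorded as `none`. -/
noncomputable def run (A : OnlineProcedure V) (N : ℕ → Finset V) :
    ℕ → PMF ((ℕ → Option V) × A.State)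
  | 0 => PMF.pure (fun _ => none, A.init)
  | n + 1 => (A.run N n).bind fun ω =>
      (A.step ω.2 (N n)).map fun r => (Function.update ω.1 n r.1, r.2)

/-- The law of the first `n` outputs. -/
noncomputable def outputs (A : OnlineProcedure V) (N : ℕ → Finset V) (n : ℕ) :
    PMF (ℕ → Option V) :=
  (A.run N n).map Prod.fst

/-- The expected number of online vertices among the first `n` that are matched. -/
noncomputable def expectedSize (A : OnlineProcedure V) (N : ℕ → Finset V) (n : ℕ) : ℝ≥0∞ :=
  ∑' M, A.outputs N n M * (size n M : ℝ≥0∞)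

/-- `A` is an online matching algorithm (for reuse time `d`) that always outputs a feasible integral
matching and has competitive ratio at least `Γ` against the offline optimum. -/
structure IsCompetitive (d : ℕ) (Γ : ℝ) (A : OnlineProcedure V) : Prop where
  feasible : ∀ N n, ∀ M ∈ (A.outputs N n).support, IsFeasible d N n M
  ratio : ∀ N n, ENNReal.ofReal Γ * (opt d N n : ℝ≥0∞) ≤ A.expectedSize N n

end OnlineProcedure

/-! ### Online correlated rental -/

section OCR

variable {V : Type u}

open Classical in
/-- The matching obtained from the selections `sel` at the times `< n`: the selected vertex is
matched whenever it is available. -/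
noncomputable def rentals (d : ℕ) (sel : ℕ → Option V) : ℕ → ℕ → Option V
  | 0 => fun _ => none
  | n + 1 => Function.update (rentals d sel n) n
      ((sel n).filter fun i => Available d (rentals d sel n) i n)

/-- `Δμ`: the probability that `i` is matched in round `j` when the sets `Q 0, Q 1, …` are proposed
to the inner algorithm `S`. -/
noncomputable def matchProb (d : ℕ) (S : OnlineProcedure V) (Q : ℕ → Finset V) (i : V) (j : ℕ) :
    ℝ :=
  (((S.outputs Q (j + 1)).map fun sel => rentals d sel (j + 1) j) (some i)).toReal

/-- `p`: the probability `1 - ∑_{t = j - d + 1}^{j - 1} Δμ` that `i` is available at time `j`. -/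
noncomputable def availProb (d : ℕ) (S : OnlineProcedure V) (Q : ℕ → Finset V) (i : V) (j : ℕ) :
    ℝ :=
  1 - ∑ t ∈ (Finset.range j).filter (fun t => j < t + d), matchProb d S Q i t

variable [DecidableEq V]

/-- The last round before `j` in which `i` was proposed, and `⊥` if there is none. -/
def prev (Q : ℕ → Finset V) (i : V) (j : ℕ) : WithBot ℕ :=
  ((Finset.range j).filter fun t => i ∈ Q t).max

/-- `u`: if `i` was last proposed in a round `j' > j - d`, the probability that `i` was available at
time `j'` but was not matched then; `0` if `i` was not proposed in the rounds
`j - d + 1, …, j - 1`. -/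
noncomputable def unusedProb (d : ℕ) (S : OnlineProcedure V) (Q : ℕ → Finset V) (i : V) (j : ℕ) :
    ℝ :=
  match prev Q i j with
  | none => 0
  | some j' => if j < j' + d then availProb d S Q i j' - matchProb d S Q i j' else 0

/-- `r = p - u`; in particular `r = p` if `i` was not proposed in the rounds
`j - d + 1, …, j - 1`. -/
noncomputable def returnProb (d : ℕ) (S : OnlineProcedure V) (Q : ℕ → Finset V) (i : V) (j : ℕ) :
    ℝ :=
  availProb d S Q i j - unusedProb d S Q i j

/-- The lower bound on `Δμ` that a `γ`-OCR guarantees for a vertex `i` proposed in round `j` in a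
set of `c` vertices: `p` in a deterministic round, `p / 2` in a randomized round if
`prev ≤ j - d`, and `p / 2 + γ (p_{prev} - Δμ_{prev})` in any other randomized round.
It depends on the proposals before round `j` only. -/
noncomputable def guarantee (d : ℕ) (γ : ℝ) (S : OnlineProcedure V) (Q : ℕ → Finset V) (i : V)
    (j : ℕ) (c : ℕ) : ℝ :=
  if c = 1 then availProb d S Q i j
  else availProb d S Q i j / 2 + γ * unusedProb d S Q i j

/-- `S` is a `γ`-OCR for reuse time `d`.  For every sequence of proposals of size at most two
(an empty proposal is a round in which nothing is proposed), it selects a proposed vertex in every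
round with a nonempty proposal, and every proposed vertex is matched with at least the
probability `guarantee`. -/
structure IsOCR (d : ℕ) (γ : ℝ) (S : OnlineProcedure V) : Prop where
  selects : ∀ Q : ℕ → Finset V, (∀ j, (Q j).card ≤ 2) →
    ∀ n, ∀ sel ∈ (S.outputs Q n).support, ∀ j < n,
      (∀ i, sel j = some i → i ∈ Q j) ∧ ((Q j).Nonempty → sel j ≠ none)
  matches_often : ∀ Q : ℕ → Finset V, (∀ j, (Q j).card ≤ 2) →
    ∀ j, ∀ i ∈ Q j, guarantee d γ S Q i j (Q j).card ≤ matchProb d S Q i j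

end OCR

/-! ### The inner algorithm -/

section Inner

variable {V : Type u}

/-- Values of the state variables `τ`. -/
inductive Status : Type u
  | unknown
  | selected
  | notSelected

variable [DecidableEq V]

/-- The assignment `τ_{i, [j + 1, j + d - 1]} = s`. -/
def assign (d j : ℕ) (i : V) (s : Status.{u}) (τ : V → ℕ → Status.{u}) : V → ℕ → Status.{u} :=
  fun v t => if v = i ∧ j < t ∧ t < j + d then s else τ v t

/-- A uniform random bit. -/
noncomputable def coin : PMF Bool := PMF.uniformOfFintype Bool

/-- A sender round with proposal `{i₁, i₂}`: `ℓ` and `m` are fair bits (`true` stands for the index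
`1` and `false` for the index `2`). -/
noncomputable def senderRound (d j : ℕ) (i₁ i₂ : V) (τ : V → ℕ → Status.{u}) :
    PMF (Option V × (V → ℕ → Status.{u})) :=
  coin.bind fun ℓ => coin.bind fun m =>
    PMF.pure (some (cond ℓ i₁ i₂),
      assign d j (cond m i₁ i₂) (if m = ℓ then Status.selected else Status.notSelected)
        (assign d j (cond m i₂ i₁) Status.unknown τ))

/-- A receiver round with proposal `{i₁, i₂}`. -/
noncomputable def receiverRound (d j : ℕ) (i₁ i₂ : V) (τ : V → ℕ → Status.{u}) :
    PMF (Option V × (V → ℕ → Status.{u})) :=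
  coin.bind fun m =>
    (match τ (cond m i₁ i₂) j with
      | Status.selected => PMF.pure (!m)
      | Status.notSelected => PMF.pure m
      | Status.unknown => coin).bind fun ℓ =>
    PMF.pure (some (cond ℓ i₁ i₂),
      assign d j i₂ Status.unknown (assign d j i₁ Status.unknown τ))

/-- Round `j` of the inner algorithm on the proposal `Q` with state variables `τ`.  A round with two
proposed vertices is a sender or a receiver round, each with probability `1 / 2`. -/
noncomputable def innerRound (d j : ℕ) (Q : Finset V) (τ : V → ℕ → Status.{u}) :
    PMF (Option V × (V → ℕ → Status.{u})) :=
  match Q.toList with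
  | [i₁] => PMF.pure (some i₁, assign d j i₁ Status.unknown τ)
  | [i₁, i₂] => coin.bind fun b =>
      if b = true then senderRound d j i₁ i₂ τ else receiverRound d j i₁ i₂ τ
  | _ => PMF.pure (none, τ)

/-- The inner selection algorithm for reuse time `d`.  Its memory consists of the current time and
the state variables `τ`, all of which are initially `unknown`. -/
noncomputable def innerAlgorithm (V : Type u) [DecidableEq V] (d : ℕ) : OnlineProcedure V where
  State := ℕ × (V → ℕ → Status.{u})
  init := (0, fun _ _ => Status.unknown)
  step := fun s Q =>
    (innerRound d s.1 Q s.2).map fun r => (r.1, (s.1 + 1, r.2))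

end Inner

/-! ### The primal-dual outer algorithm -/

section Outer

variable {V : Type u}

/-- The state of the two-layer algorithm: the memory of the inner algorithm, the current time, the
past proposals and the matching found so far. -/
structure OuterState (S : OnlineProcedure V) : Type u where
  inner : S.State
  time : ℕ
  proposals : ℕ → Finset V
  matching : ℕ → Option V

/-- A rule for proposals: from the current time `j`, the earlier proposals (a sequence whose entries
at times `≥ j` are empty) and the neighbours of the arriving vertex, it computes the set to be
proposed. -/
abbrev ProposalRule (V : Type u) := ℕ → (ℕ → Finset V) → Finset V → Finset V

open Classical in
/-- The two-layer online matching algorithm: in every round, propose a set to the inner algorithm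
`S`, and match the selected vertex if it is available. -/
noncomputable def twoLayer (d : ℕ) (S : OnlineProcedure V) (rule : ProposalRule V) :
    OnlineProcedure V where
  State := OuterState S
  init := ⟨S.init, 0, fun _ => ∅, fun _ => none⟩
  step := fun s nbrs =>
    let Q := rule s.time s.proposals nbrs
    (S.step s.inner Q).map fun r =>
      let out := r.1.filter fun i => Available d s.matching i s.time
      (out, ⟨r.2, s.time + 1, Function.update s.proposals s.time Q,
        Function.update s.matching s.time out⟩)

variable [DecidableEq V]

/-- The value `β_j = ∑_{i ∈ R} (β₁ r / 2 + β₂ (Δμ - r / 2))` of the dual variable of the online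
vertex `j` if the set `R` is proposed in round `j` after the proposals `Q 0, …, Q (j - 1)`, where
`Δμ` is the matching probability guaranteed by the `γ`-OCR. -/
noncomputable def dualGain (d : ℕ) (γ β₁ β₂ : ℝ) (S : OnlineProcedure V) (Q : ℕ → Finset V)
    (j : ℕ) (R : Finset V) : ℝ :=
  ∑ i ∈ R, (β₁ * (returnProb d S Q i j / 2) +
    β₂ * (guarantee d γ S Q i j R.card - returnProb d S Q i j / 2))

/-- The rule proposes a set of at most two neighbours that maximizes `β_j`, with arbitrary
tie-breaking. -/
def IsPrimalDualRule (d : ℕ) (γ β₁ β₂ : ℝ) (S : OnlineProcedure V) (rule : ProposalRule V) :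
    Prop :=
  ∀ (j : ℕ) (Q : ℕ → Finset V) (nbrs : Finset V),
    rule j Q nbrs ⊆ nbrs ∧ (rule j Q nbrs).card ≤ 2 ∧
      ∀ R ⊆ nbrs, R.card ≤ 2 →
        dualGain d γ β₁ β₂ S Q j R ≤ dualGain d γ β₁ β₂ S Q j (rule j Q nbrs)

end Outer

end ReusableMatching

/-!
The two parts of the theorem, the analysis of the inner algorithm and that of the primal-dual
algorithm, are independent.  Write `m`, `p`, `u`, `r` for `matchProb`, `availProb`, `unusedProb` and
`returnProb`.

**The inner algorithm.**  Selections do not depend on availability.  Given the past, a round with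
proposal `{i, k}` selects `i` with probability `1 / 2`, corrected by `1 / 8` for each known status:
upwards if `i` is recorded as not selected or `k` as selected, downwards in the other two cases
(`eight_mul_mean_select`).  So one has to know how the availability of `i` correlates with the
recorded statuses.  The tool is a symmetry: exchanging the values `selected` and `notSelected` of
the status of a vertex `v`, together with the selection in the sender round that produced it,
preserves the law of the run (`mean_innerRun_swap`), because no round before the next proposal of
`v` reads this status.

* For `v = k`, the exchange can only cost `i` its availability when it makes the sender round select
  `i` instead of `k`.  So the status of `k` is correlated with the availability of `i` in the
  favourable direction (`mean_notSelected_le`).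
* For `v = i`, with last proposal `s`, the runs in which `i` was available at time `s` contribute
  nothing to `selected`, as `i` is then still rented, and `p s / 8` to `notSelected`
  (`mean_selected_add_le`, `eight_mul_mean_selected`).

This gives `m ≥ p / 2` at first.  Hence `u = p s - m s ≤ p s / 2`, and the gain `p s / 64` of the
second comparison is at least `u / 32`.

**The primal-dual algorithm.**  The proposals are deterministic, so the expected size is the sum of
all `m i j` with `i` proposed in round `j` (`twoLayer_expectedSize`).  It pays for a dual solution:
the online vertex `j` gets the value `dualGain` that the rule maximizes, and each proposed `i` gets
`offlineGain`; in round `j` this is at most the sum of the `m i j`.  In an offline optimum the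
windows of `d` rounds ending at the times when `i` is used are disjoint, so it suffices to bound
from below, for each edge `(i, j)`, the dual variable of `j` plus what `i` gained in the window
ending at `j` (`dual_feasible`).  There the probability mass of `i` is conserved: what was matched
in the window and what is available at time `j` add up to `1`, while the masses `r` that returned in
the window add up to at most `1` (`sum_returnProb_le`).  If `i` is proposed in round `j`, the
singleton `{i}` already makes the dual variable large enough; otherwise the comparison of the
proposal with sets containing `i` does (`le_dualGain_of_notMem`), and in this case the constant
`50 / 99` comes out exactly.
-/

namespace ReusableMatching

/-! ### Expectations over discrete distributions -/

section Mean

variable {α β : Type*}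

/-- The expectation of a nonnegative function under a discrete distribution. -/
noncomputable def mean (p : PMF α) (f : α → ℝ≥0∞) : ℝ≥0∞ := ∑' a, p a * f a

open Classical in
/-- The indicator of a proposition. -/
noncomputable def ind (P : Prop) : ℝ≥0∞ := if P then 1 else 0

theorem ind_of {P : Prop} (h : P) : ind P = 1 := if_pos h

theorem ind_of_not {P : Prop} (h : ¬P) : ind P = 0 := if_neg h

theorem ind_le_one (P : Prop) : ind P ≤ 1 := by
  by_cases h : P <;> simp [ind, h]

theorem ind_mono {P R : Prop} (h : P → R) : ind P ≤ ind R := by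
  by_cases hP : P
  · rw [ind_of hP, ind_of (h hP)]
  · rw [ind_of_not hP]; exact zero_le

theorem ind_and (P R : Prop) : ind (P ∧ R) = ind P * ind R := by
  by_cases hP : P <;> by_cases hR : R <;> simp [ind, hP, hR]

theorem mean_pure (a : α) (f : α → ℝ≥0∞) : mean (PMF.pure a) f = f a := by
  classical
  rw [mean, tsum_eq_single a]
  · simp
  · intro b hb
    simp [PMF.pure_apply, hb]

theorem mean_bind (p : PMF α) (q : α → PMF β) (f : β → ℝ≥0∞) :
    mean (p.bind q) f = mean p fun a => mean (q a) f := by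
  simp only [mean, PMF.bind_apply, ← ENNReal.tsum_mul_right, ← ENNReal.tsum_mul_left, mul_assoc]
  exact ENNReal.tsum_comm

theorem mean_map (p : PMF α) (g : α → β) (f : β → ℝ≥0∞) :
    mean (p.map g) f = mean p fun a => f (g a) := by
  rw [← PMF.bind_pure_comp, mean_bind]
  simp [mean_pure]

theorem mean_congr {p : PMF α} {f g : α → ℝ≥0∞} (h : ∀ a ∈ p.support, f a = g a) :
    mean p f = mean p g := by
  refine tsum_congr fun a => ?_
  by_cases ha : a ∈ p.support
  · rw [h a ha]
  · rw [(p.apply_eq_zero_iff a).2 ha, zero_mul, zero_mul]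

theorem mean_mono {p : PMF α} {f g : α → ℝ≥0∞} (h : ∀ a ∈ p.support, f a ≤ g a) :
    mean p f ≤ mean p g := by
  refine ENNReal.tsum_le_tsum fun a => ?_
  by_cases ha : a ∈ p.support
  · exact mul_le_mul_right (h a ha) _
  · rw [(p.apply_eq_zero_iff a).2 ha, zero_mul, zero_mul]

theorem mean_add (p : PMF α) (f g : α → ℝ≥0∞) :
    mean p (fun a => f a + g a) = mean p f + mean p g := by
  simp only [mean, mul_add, ENNReal.tsum_add]

theorem mean_mul_left (p : PMF α) (c : ℝ≥0∞) (f : α → ℝ≥0∞) :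
    mean p (fun a => c * f a) = c * mean p f := by
  simp only [mean, ← ENNReal.tsum_mul_left]
  exact tsum_congr fun a => by ring

theorem mean_const (p : PMF α) (c : ℝ≥0∞) : mean p (fun _ => c) = c := by
  rw [mean, ENNReal.tsum_mul_right, p.tsum_coe, one_mul]

theorem mean_sum {ι : Type*} (s : Finset ι) (p : PMF α) (f : ι → α → ℝ≥0∞) :
    mean p (fun a => ∑ i ∈ s, f i a) = ∑ i ∈ s, mean p (f i) := by
  classical
  induction s using Finset.induction_on with
  | empty => simpa using mean_const p 0
  | insert i s hi ih => simp only [Finset.sum_insert hi, mean_add, ih]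

theorem mean_ind_le_one (p : PMF α) (E : α → Prop) : mean p (fun a => ind (E a)) ≤ 1 :=
  (mean_mono fun a _ => ind_le_one (E a)).trans (mean_const p 1).le

theorem mean_ind_ne_top (p : PMF α) (E : α → Prop) : mean p (fun a => ind (E a)) ≠ ⊤ :=
  ne_top_of_le_ne_top ENNReal.one_ne_top (mean_ind_le_one p E)

theorem map_apply_eq_mean (p : PMF α) (g : α → β) (b : β) :
    (p.map g) b = mean p fun a => ind (g a = b) := by
  rw [PMF.map_apply]
  refine tsum_congr fun a => ?_
  by_cases h : b = g a
  · simp [h, ind]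
  · simp [h, ind, Ne.symm h]

end Mean

/-! ### Runs of online procedures -/

section Run

variable {V : Type u} (S : OnlineProcedure V)

theorem mean_run_succ (Q : ℕ → Finset V) (n : ℕ) (f : (ℕ → Option V) × S.State → ℝ≥0∞) :
    mean (S.run Q (n + 1)) f = mean (S.run Q n) fun ω =>
      mean (S.step ω.2 (Q n)) fun r => f (Function.update ω.1 n r.1, r.2) := by
  rw [OnlineProcedure.run, mean_bind]
  simp only [mean_map]

theorem mean_outputs (Q : ℕ → Finset V) (n : ℕ) (f : (ℕ → Option V) → ℝ≥0∞) :
    mean (S.outputs Q n) f = mean (S.run Q n) fun ω => f ω.1 := by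
  rw [OnlineProcedure.outputs, mean_map]

/-- The run of `n` rounds depends on the inputs of these rounds only. -/
theorem run_congr {Q Q' : ℕ → Finset V} {n : ℕ} (h : ∀ t < n, Q t = Q' t) :
    S.run Q n = S.run Q' n := by
  induction n with
  | zero => rfl
  | succ n ih =>
    rw [OnlineProcedure.run, OnlineProcedure.run, ih fun t ht => h t (ht.trans n.lt_succ_self),
      h n n.lt_succ_self]

/-- Later rounds do not change the law of what has been output before. -/
theorem mean_outputs_of_le (Q : ℕ → Finset V) {m n : ℕ} (hmn : m ≤ n)
    {f : (ℕ → Option V) → ℝ≥0∞}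
    (hf : ∀ a b : ℕ → Option V, (∀ t < m, a t = b t) → f a = f b) :
    mean (S.outputs Q n) f = mean (S.outputs Q m) f := by
  induction n, hmn using Nat.le_induction with
  | base => rfl
  | succ n hmn ih =>
    rw [← ih, mean_outputs, mean_outputs, mean_run_succ]
    refine mean_congr fun ω _ => ?_
    rw [← mean_const (S.step ω.2 (Q n)) (f ω.1)]
    refine mean_congr fun r _ => hf _ _ fun t ht => ?_
    exact Function.update_of_ne (ht.trans_le hmn).ne _ _

end Run

/-! ### The matching obtained from the selections -/

section Rented

variable {V : Type u} (d : ℕ)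

/-- The matching of all online vertices obtained from the selections `sel`. -/
noncomputable def rented (sel : ℕ → Option V) (t : ℕ) : Option V := rentals d sel (t + 1) t

theorem Available.congr {d : ℕ} {M M' : ℕ → Option V} {i : V} {j : ℕ}
    (h : ∀ t < j, M t = some i ↔ M' t = some i) : Available d M i j ↔ Available d M' i j :=
  ⟨fun H t ht hM => H t ht ((h t ht).2 hM), fun H t ht hM => H t ht ((h t ht).1 hM)⟩

theorem rentals_of_lt (sel : ℕ → Option V) {n t : ℕ} (h : t < n) :
    rentals d sel n t = rented d sel t := by
  induction n, Nat.succ_le_of_lt h using Nat.le_induction with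
  | base => rfl
  | succ n hn ih =>
    rw [rentals, Function.update_of_ne (Nat.ne_of_lt hn)]
    exact ih hn

theorem rentals_of_le (sel : ℕ → Option V) {n t : ℕ} (h : n ≤ t) : rentals d sel n t = none := by
  induction n with
  | zero => rfl
  | succ n ih =>
    rw [rentals, Function.update_of_ne (Nat.ne_of_gt h)]
    exact ih (Nat.le_of_succ_le h)

/-- A selected vertex is matched if and only if it is available. -/
theorem rented_eq_some_iff (sel : ℕ → Option V) (i : V) (t : ℕ) :
    rented d sel t = some i ↔ sel t = some i ∧ Available d (rented d sel) i t := by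
  have h : Available d (rentals d sel t) i t ↔ Available d (rented d sel) i t :=
    Available.congr fun s hs => by rw [rentals_of_lt d sel hs]
  rw [rented, rentals, Function.update_self, Option.filter_eq_some_iff, ← h]
  simp

theorem rented_congr {a b : ℕ → Option V} {n : ℕ} (h : ∀ t < n, a t = b t) :
    ∀ t < n, rented d a t = rented d b t := by
  intro t
  induction t using Nat.strong_induction_on with
  | _ t ih =>
    intro ht
    ext i
    simp only [rented_eq_some_iff, h t ht]
    refine and_congr_right fun _ => Available.congr fun s hs => ?_
    rw [ih s hs (hs.trans ht)]

theorem rentals_congr {a b : ℕ → Option V} {n : ℕ} (h : ∀ t < n, a t = b t) :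
    rentals d a n = rentals d b n := by
  ext1 t
  rcases lt_or_ge t n with ht | ht
  · rw [rentals_of_lt d a ht, rentals_of_lt d b ht, rented_congr d h t ht]
  · rw [rentals_of_le d a ht, rentals_of_le d b ht]

theorem available_rented_congr {a b : ℕ → Option V} {n : ℕ} (h : ∀ t < n, a t = b t) (i : V) :
    Available d (rented d a) i n ↔ Available d (rented d b) i n :=
  Available.congr fun t ht => by rw [rented_congr d h t ht]

/-- Let `s` be a time whose matches still block at time `j`.  If `b` does not select `i` at time `s`
and otherwise selects `i` exactly when `a` does, then `i` is available at time `j` under `b`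
whenever it is under `a`: in this case `a` does not match `i` at time `s` either. -/
theorem available_of_deselect {a b : ℕ → Option V} {i : V} {s j : ℕ} (hsj : s < j) (hj : j < s + d)
    (hb : b s ≠ some i) (hab : ∀ t < j, t ≠ s → (a t = some i ↔ b t = some i))
    (ha : Available d (rented d a) i j) : Available d (rented d b) i j := by
  have key : ∀ t < j, (rented d a t = some i ↔ rented d b t = some i) := by
    intro t
    induction t using Nat.strong_induction_on with
    | _ t ih =>
      intro ht
      by_cases hts : t = s
      · subst hts
        refine iff_of_false (fun h => ?_) fun h => hb ((rented_eq_some_iff d b i t).1 h).1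
        exact absurd (ha t ht h) (not_le.2 hj)
      · rw [rented_eq_some_iff, rented_eq_some_iff, hab t ht hts]
        exact and_congr_right fun _ => Available.congr fun r hr => ih r hr (hr.trans ht)
  exact (Available.congr key).1 ha

/-- A vertex is either available or matched at exactly one of the last `d - 1` times. -/
theorem ind_available_add_sum (sel : ℕ → Option V) (i : V) (j : ℕ) :
    ind (Available d (rented d sel) i j) +
      ∑ t ∈ (Finset.range j).filter (fun t => j < t + d), ind (rented d sel t = some i) = 1 := by
  by_cases h : Available d (rented d sel) i j
  · rw [ind_of h, Finset.sum_eq_zero, add_zero]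
    intro t ht
    rw [Finset.mem_filter, Finset.mem_range] at ht
    exact ind_of_not fun hM => absurd (h t ht.1 hM) (not_le.2 ht.2)
  · rw [ind_of_not h, zero_add]
    simp only [Available, not_forall, not_le] at h
    obtain ⟨t, htj, hM, hd⟩ := h
    rw [Finset.sum_eq_single t, ind_of hM]
    · intro s hs hst
      rw [Finset.mem_filter, Finset.mem_range] at hs
      refine ind_of_not fun hs' => ?_
      rcases lt_or_gt_of_ne hst with hlt | hlt
      · have := ((rented_eq_some_iff d sel i t).1 hM).2 s hlt hs'
        omega
      · have := ((rented_eq_some_iff d sel i s).1 hs').2 t hlt hM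
        omega
    · intro ht
      exact absurd (Finset.mem_filter.2 ⟨Finset.mem_range.2 htj, hd⟩) ht

end Rented

/-! ### The probabilities of being matched and of being available -/

section Probabilities

variable {V : Type u} (d : ℕ) (S : OnlineProcedure V)

theorem matchProb_eq_mean (Q : ℕ → Finset V) (i : V) {j n : ℕ} (h : j < n) :
    matchProb d S Q i j =
      (mean (S.outputs Q n) fun sel => ind (rented d sel j = some i)).toReal := by
  rw [matchProb, map_apply_eq_mean, mean_outputs_of_le S Q (Nat.succ_le_of_lt h)]
  · rfl
  · intro a b hab
    rw [rented_congr d hab j j.lt_succ_self]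

theorem ofReal_matchProb (Q : ℕ → Finset V) (i : V) {j n : ℕ} (h : j < n) :
    ENNReal.ofReal (matchProb d S Q i j) =
      mean (S.outputs Q n) fun sel => ind (rented d sel j = some i) := by
  rw [matchProb_eq_mean d S Q i h, ENNReal.ofReal_toReal (mean_ind_ne_top _ _)]

theorem matchProb_nonneg (Q : ℕ → Finset V) (i : V) (j : ℕ) : 0 ≤ matchProb d S Q i j :=
  ENNReal.toReal_nonneg

theorem availProb_eq_mean (Q : ℕ → Finset V) (i : V) (j : ℕ) :
    availProb d S Q i j =
      (mean (S.outputs Q j) fun sel => ind (Available d (rented d sel) i j)).toReal := by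
  have h : mean (S.outputs Q j) (fun sel => ind (Available d (rented d sel) i j) +
      ∑ t ∈ (Finset.range j).filter (fun t => j < t + d), ind (rented d sel t = some i)) = 1 := by
    rw [← mean_const (S.outputs Q j) 1]
    exact mean_congr fun sel _ => ind_available_add_sum d sel i j
  rw [mean_add, mean_sum] at h
  have h' := congrArg ENNReal.toReal h
  rw [ENNReal.toReal_add (mean_ind_ne_top _ _)
    (ENNReal.sum_ne_top.2 fun t _ => mean_ind_ne_top _ _),
    ENNReal.toReal_sum fun t _ => mean_ind_ne_top _ _, ENNReal.toReal_one] at h'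
  rw [availProb, eq_comm, ← h', eq_sub_iff_add_eq]
  congr 1
  refine Finset.sum_congr rfl fun t ht => matchProb_eq_mean d S Q i ?_
  exact Finset.mem_range.1 (Finset.mem_filter.1 ht).1

theorem availProb_nonneg (Q : ℕ → Finset V) (i : V) (j : ℕ) : 0 ≤ availProb d S Q i j := by
  rw [availProb_eq_mean]
  exact ENNReal.toReal_nonneg

theorem matchProb_le_availProb (Q : ℕ → Finset V) (i : V) (j : ℕ) :
    matchProb d S Q i j ≤ availProb d S Q i j := by
  rw [availProb_eq_mean, matchProb_eq_mean d S Q i j.lt_succ_self]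
  refine ENNReal.toReal_mono (mean_ind_ne_top _ _) ?_
  rw [← mean_outputs_of_le S Q j.le_succ
    (f := fun sel => ind (Available d (rented d sel) i j)) (fun a b hab => by
      rw [available_rented_congr d hab])]
  exact mean_mono fun sel _ => ind_mono fun h => ((rented_eq_some_iff d sel i j).1 h).2

theorem matchProb_congr {Q Q' : ℕ → Finset V} {j n : ℕ} (h : ∀ t < n, Q t = Q' t) (hj : j < n)
    (i : V) : matchProb d S Q i j = matchProb d S Q' i j := by
  rw [matchProb_eq_mean d S Q i hj, matchProb_eq_mean d S Q' i hj, OnlineProcedure.outputs,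
    OnlineProcedure.outputs, run_congr S h]

theorem availProb_congr {Q Q' : ℕ → Finset V} {j : ℕ} (h : ∀ t < j, Q t = Q' t) (i : V) :
    availProb d S Q i j = availProb d S Q' i j := by
  rw [availProb_eq_mean, availProb_eq_mean, OnlineProcedure.outputs, OnlineProcedure.outputs,
    run_congr S h]

variable [DecidableEq V]

/-- `s` is the last round before `j` in which `i` was proposed. -/
def IsLastProposal (Q : ℕ → Finset V) (i : V) (j s : ℕ) : Prop :=
  s < j ∧ i ∈ Q s ∧ ∀ t, s < t → t < j → i ∉ Q t

theorem IsLastProposal.prev_eq {Q : ℕ → Finset V} {i : V} {j s : ℕ} (h : IsLastProposal Q i j s) :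
    prev Q i j = some s := by
  refine le_antisymm (Finset.max_le fun t ht => ?_) (Finset.le_max ?_)
  · rw [Finset.mem_filter, Finset.mem_range] at ht
    exact WithBot.coe_le_coe.2 (not_lt.1 fun hst => h.2.2 t hst ht.1 ht.2)
  · exact Finset.mem_filter.2 ⟨Finset.mem_range.2 h.1, h.2.1⟩

theorem exists_isLastProposal {Q : ℕ → Finset V} {i : V} {j t : ℕ} (htj : t < j) (ht : i ∈ Q t) :
    ∃ s, t ≤ s ∧ IsLastProposal Q i j s := by
  have hmem : t ∈ (Finset.range j).filter fun t => i ∈ Q t :=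
    Finset.mem_filter.2 ⟨Finset.mem_range.2 htj, ht⟩
  obtain ⟨s, hs, hmax⟩ := Finset.exists_max_image _ id ⟨t, hmem⟩
  rw [Finset.mem_filter, Finset.mem_range] at hs
  refine ⟨s, hmax t hmem, hs.1, hs.2, fun r hsr hrj hr => ?_⟩
  exact absurd (hmax r (Finset.mem_filter.2 ⟨Finset.mem_range.2 hrj, hr⟩)) (not_le.2 hsr)

theorem unusedProb_of_isLastProposal {Q : ℕ → Finset V} {i : V} {j s : ℕ}
    (h : IsLastProposal Q i j s) (hd : j < s + d) :
    unusedProb d S Q i j = availProb d S Q i s - matchProb d S Q i s := by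
  rw [unusedProb, h.prev_eq]
  exact if_pos hd

theorem unusedProb_eq_zero {Q : ℕ → Finset V} {i : V} {j : ℕ}
    (h : ∀ s, IsLastProposal Q i j s → s + d ≤ j) : unusedProb d S Q i j = 0 := by
  by_cases hex : ∃ t < j, i ∈ Q t
  · obtain ⟨t, htj, ht⟩ := hex
    obtain ⟨s, -, hs⟩ := exists_isLastProposal htj ht
    rw [unusedProb, hs.prev_eq]
    exact if_neg (not_lt.2 (h s hs))
  · have : prev Q i j = none := by
      rw [prev, Finset.filter_eq_empty_iff.2 fun t ht hi => hex ⟨t, Finset.mem_range.1 ht, hi⟩]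
      rfl
    rw [unusedProb, this]

theorem unusedProb_nonneg (Q : ℕ → Finset V) (i : V) (j : ℕ) : 0 ≤ unusedProb d S Q i j := by
  by_cases h : ∀ s, IsLastProposal Q i j s → s + d ≤ j
  · exact (unusedProb_eq_zero d S h).ge
  · push Not at h
    obtain ⟨s, hs, hd⟩ := h
    rw [unusedProb_of_isLastProposal d S hs hd]
    exact sub_nonneg.2 (matchProb_le_availProb d S Q i s)

theorem unusedProb_congr {Q Q' : ℕ → Finset V} {j : ℕ} (h : ∀ t < j, Q t = Q' t) (i : V) :
    unusedProb d S Q i j = unusedProb d S Q' i j := by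
  have hlast : ∀ s, IsLastProposal Q i j s ↔ IsLastProposal Q' i j s := by
    intro s
    refine and_congr_right fun hs => ?_
    rw [h s hs]
    refine and_congr_right fun _ => forall_congr' fun t => forall_congr' fun _ =>
      forall_congr' fun ht => ?_
    rw [h t ht]
  by_cases hz : ∀ s, IsLastProposal Q i j s → s + d ≤ j
  · rw [unusedProb_eq_zero d S hz, unusedProb_eq_zero d S fun s hs => hz s ((hlast s).2 hs)]
  · push Not at hz
    obtain ⟨s, hs, hd⟩ := hz
    rw [unusedProb_of_isLastProposal d S hs hd,
      unusedProb_of_isLastProposal d S ((hlast s).1 hs) hd,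
      availProb_congr d S fun t ht => h t (ht.trans hs.1), matchProb_congr d S h hs.1]

theorem dualGain_congr {Q Q' : ℕ → Finset V} {j : ℕ} (h : ∀ t < j, Q t = Q' t) (γ β₁ β₂ : ℝ)
    (R : Finset V) : dualGain d γ β₁ β₂ S Q j R = dualGain d γ β₁ β₂ S Q' j R := by
  simp only [dualGain, returnProb, guarantee, availProb_congr d S h, unusedProb_congr d S h]

end Probabilities

/-! ### The two-layer algorithm as a function of the selections -/

section TwoLayer

variable {V : Type u}

/-- The proposals made before round `n` on the input `N`, followed by empty ones. -/
def history (rule : ProposalRule V) (N : ℕ → Finset V) : ℕ → ℕ → Finset V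
  | 0 => fun _ => ∅
  | n + 1 => Function.update (history rule N n) n (rule n (history rule N n) (N n))

/-- The proposals on the input `N`.  They are deterministic, since the rule consults the laws of the
inner algorithm only and not its random choices. -/
def proposals (rule : ProposalRule V) (N : ℕ → Finset V) (n : ℕ) : Finset V :=
  rule n (history rule N n) (N n)

theorem history_of_lt (rule : ProposalRule V) (N : ℕ → Finset V) {n t : ℕ} (h : t < n) :
    history rule N n t = proposals rule N t := by
  induction n, Nat.succ_le_of_lt h using Nat.le_induction with
  | base => exact Function.update_self _ _ _
  | succ n hn ih =>
    rw [history, Function.update_of_ne (Nat.ne_of_lt hn)]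
    exact ih hn

variable (d : ℕ) (S : OnlineProcedure V)

theorem twoLayer_run (rule : ProposalRule V) (N : ℕ → Finset V) (n : ℕ) :
    (twoLayer d S rule).run N n = (S.run (proposals rule N) n).map fun ω =>
      (rentals d ω.1 n, ⟨ω.2, n, history rule N n, rentals d ω.1 n⟩) := by
  induction n with
  | zero =>
    rw [OnlineProcedure.run, OnlineProcedure.run, PMF.pure_map]
    rfl
  | succ n ih =>
    rw [OnlineProcedure.run, ih, PMF.bind_map, OnlineProcedure.run, PMF.map_bind]
    congr 1
    ext1 ω
    have hr : ∀ x, rentals d (Function.update ω.1 n x) n = rentals d ω.1 n := fun x =>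
      rentals_congr d fun t ht => Function.update_of_ne ht.ne _ _
    simp only [Function.comp_apply, twoLayer, PMF.map_comp, proposals]
    congr 1
    ext1 r
    simp only [Function.comp_apply, rentals, Function.update_self, history]
    rw [hr]

theorem twoLayer_outputs (rule : ProposalRule V) (N : ℕ → Finset V) (n : ℕ) :
    (twoLayer d S rule).outputs N n =
      (S.outputs (proposals rule N) n).map fun sel => rentals d sel n := by
  rw [OnlineProcedure.outputs, twoLayer_run, OnlineProcedure.outputs, PMF.map_comp, PMF.map_comp]
  rfl

variable {d S}

theorem twoLayer_feasible [DecidableEq V] {γ : ℝ} (hS : IsOCR d γ S) {rule : ProposalRule V}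
    {N : ℕ → Finset V} (hcard : ∀ j, (proposals rule N j).card ≤ 2)
    (hsub : ∀ j, proposals rule N j ⊆ N j) (n : ℕ) {M : ℕ → Option V}
    (hM : M ∈ ((twoLayer d S rule).outputs N n).support) : IsFeasible d N n M := by
  rw [twoLayer_outputs, PMF.mem_support_map_iff] at hM
  obtain ⟨sel, hsel, rfl⟩ := hM
  intro j hj i hi
  rw [rentals_of_lt d sel hj, rented_eq_some_iff] at hi
  refine ⟨hsub j ((hS.selects _ hcard n sel hsel j hj).1 i hi.1), ?_⟩
  refine (Available.congr fun t ht => ?_).1 hi.2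
  rw [rentals_of_lt d sel (ht.trans hj)]

theorem twoLayer_expectedSize [DecidableEq V] {γ : ℝ} (hS : IsOCR d γ S) {rule : ProposalRule V}
    {N : ℕ → Finset V} (hcard : ∀ j, (proposals rule N j).card ≤ 2) (n : ℕ) :
    (twoLayer d S rule).expectedSize N n = ENNReal.ofReal (∑ j ∈ Finset.range n,
      ∑ i ∈ proposals rule N j, matchProb d S (proposals rule N) i j) := by
  have hsize : (twoLayer d S rule).expectedSize N n =
      mean ((twoLayer d S rule).outputs N n) fun M => (size n M : ℝ≥0∞) := rfl
  rw [hsize, twoLayer_outputs, mean_map, ENNReal.ofReal_sum_of_nonneg fun j _ =>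
    Finset.sum_nonneg fun i _ => matchProb_nonneg d S _ i j]
  have hmean : ∀ j ∈ Finset.range n, ENNReal.ofReal (∑ i ∈ proposals rule N j,
      matchProb d S (proposals rule N) i j) = mean (S.outputs (proposals rule N) n) fun sel =>
        ∑ i ∈ proposals rule N j, ind (rented d sel j = some i) := by
    intro j hj
    rw [ENNReal.ofReal_sum_of_nonneg fun i _ => matchProb_nonneg d S _ i j, mean_sum]
    exact Finset.sum_congr rfl fun i _ => ofReal_matchProb d S _ i (Finset.mem_range.1 hj)
  rw [Finset.sum_congr rfl hmean, ← mean_sum]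
  refine mean_congr fun sel hsel => ?_
  rw [size, Finset.card_filter, Nat.cast_sum]
  refine Finset.sum_congr rfl fun j hj => ?_
  have hj := Finset.mem_range.1 hj
  rw [rentals_of_lt d sel hj]
  cases hr : rented d sel j with
  | none => simp [ind]
  | some k =>
    have hk := (hS.selects _ hcard n sel hsel j hj).1 k ((rented_eq_some_iff d sel k j).1 hr).1
    rw [Finset.sum_eq_single_of_mem k hk fun i _ hi =>
      ind_of_not fun h => hi (Option.some_injective _ h).symm]
    simp [ind]

end TwoLayer

/-! ### The probabilities of a correlated rental scheme -/

section OCR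

variable {V : Type u} {d : ℕ} {γ : ℝ} {S : OnlineProcedure V} {Q : ℕ → Finset V}

/-- A sum over a window of rounds in which `i` is proposed splits at the last proposal. -/
theorem sum_window_of_isLastProposal {i : V} {g : ℕ → ℝ} (hg : ∀ t, i ∉ Q t → g t = 0)
    {j s s' : ℕ} (hs : IsLastProposal Q i s s') (hj : j < s' + d) :
    ∑ t ∈ (Finset.range s).filter (fun t => j < t + d), g t =
      g s' + ∑ t ∈ (Finset.range s').filter (fun t => j < t + d), g t := by
  rw [← Finset.sum_insert (by simp)]
  refine (Finset.sum_subset (fun t ht => ?_) fun t ht hn => hg t ?_).symm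
  · rw [Finset.mem_insert, Finset.mem_filter, Finset.mem_range] at ht
    rw [Finset.mem_filter, Finset.mem_range]
    have := hs.1
    omega
  · rw [Finset.mem_filter, Finset.mem_range] at ht
    rw [Finset.mem_insert, Finset.mem_filter, Finset.mem_range] at hn
    exact hs.2.2 t (by omega) ht.1

variable [DecidableEq V]

theorem matchProb_eq_zero (hS : IsOCR d γ S) (hQ : ∀ j, (Q j).card ≤ 2) {i : V} {j : ℕ}
    (hi : i ∉ Q j) : matchProb d S Q i j = 0 := by
  rw [matchProb_eq_mean d S Q i j.lt_succ_self, ← ENNReal.toReal_zero]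
  congr 1
  rw [← mean_const (S.outputs Q (j + 1)) 0]
  refine mean_congr fun sel hsel => ind_of_not fun h => hi ?_
  exact (hS.selects Q hQ _ sel hsel j j.lt_succ_self).1 i ((rented_eq_some_iff d sel i j).1 h).1

theorem returnProb_nonneg (hS : IsOCR d γ S) (hQ : ∀ j, (Q j).card ≤ 2) (i : V) (j : ℕ) :
    0 ≤ returnProb d S Q i j := by
  rw [returnProb, sub_nonneg]
  by_cases h : ∀ s, IsLastProposal Q i j s → s + d ≤ j
  · rw [unusedProb_eq_zero d S h]
    exact availProb_nonneg d S Q i j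
  push Not at h
  obtain ⟨s, hs, hd⟩ := h
  rw [unusedProb_of_isLastProposal d S hs hd, availProb, availProb, sub_sub]
  refine sub_le_sub_left ?_ 1
  rw [add_comm, ← Finset.sum_insert (f := fun t => matchProb d S Q i t) (by simp)]
  rw [← Finset.sum_filter_ne_zero]
  refine Finset.sum_le_sum_of_subset_of_nonneg (fun t ht => ?_) fun t _ _ =>
    matchProb_nonneg d S Q i t
  rw [Finset.mem_filter, Finset.mem_filter, Finset.mem_range] at ht
  obtain ⟨ht, hne⟩ := ht
  rw [Finset.mem_insert, Finset.mem_filter, Finset.mem_range]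
  have hts : t ≤ s := by
    by_contra hst
    exact hne (matchProb_eq_zero hS hQ (hs.2.2 t (not_le.1 hst) ht.1))
  rcases hts.eq_or_lt with h | h
  · exact Or.inl h
  · exact Or.inr ⟨h, by have := hs.1; omega⟩

/-- In the window of the last `d - 1` rounds, the probability mass of `i` that returned before its
proposals has been matched since or is still unused. -/
theorem sum_returnProb_le (hS : IsOCR d γ S) (hQ : ∀ j, (Q j).card ≤ 2) (i : V) {j s : ℕ}
    (hs : s ≤ j) :
    ∑ t ∈ (Finset.range s).filter (fun t => j < t + d),
        (if i ∈ Q t then returnProb d S Q i t else 0) ≤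
      unusedProb d S Q i s +
        ∑ t ∈ (Finset.range s).filter (fun t => j < t + d), matchProb d S Q i t := by
  induction s using Nat.strong_induction_on with
  | _ s ih =>
    by_cases hex : ∃ t < s, j < t + d ∧ i ∈ Q t
    · obtain ⟨t, hts, htd, ht⟩ := hex
      obtain ⟨s', hts', hlast⟩ := exists_isLastProposal hts ht
      have hs' := ih s' hlast.1 (hlast.1.le.trans hs)
      rw [sum_window_of_isLastProposal (fun t ht => if_neg ht) hlast (by omega),
        sum_window_of_isLastProposal (fun t ht => matchProb_eq_zero hS hQ ht) hlast (by omega),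
        unusedProb_of_isLastProposal d S hlast (by omega), if_pos hlast.2.1, returnProb]
      linarith
    · rw [Finset.sum_eq_zero]
      · exact add_nonneg (unusedProb_nonneg d S Q i s)
          (Finset.sum_nonneg fun t _ => matchProb_nonneg d S Q i t)
      · intro t ht
        rw [Finset.mem_filter, Finset.mem_range] at ht
        exact if_neg fun h => hex ⟨t, ht.1, ht.2, h⟩

end OCR

/-! ### The dual solution -/

section Dual

variable {V : Type u} [DecidableEq V] {d : ℕ} {S : OnlineProcedure V} {Q : ℕ → Finset V}

/-- The increase of the dual variable of the offline vertex `i` in round `t`: the part of the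
matching probability that is not credited to the online vertex, with the complementary rates
`1 - β₁ = 49 / 99` and `1 - β₂ = 51 / 99`. -/
noncomputable def offlineGain (d : ℕ) (S : OnlineProcedure V) (Q : ℕ → Finset V) (i : V) (t : ℕ) :
    ℝ :=
  if i ∈ Q t then
    49 / 99 * (returnProb d S Q i t / 2) +
      51 / 99 * (matchProb d S Q i t - returnProb d S Q i t / 2)
  else 0

theorem half_availProb_le (hS : IsOCR d (1 / 32) S) (hQ : ∀ j, (Q j).card ≤ 2) {i : V} {j : ℕ}
    (hi : i ∈ Q j) : availProb d S Q i j / 2 ≤ matchProb d S Q i j := by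
  refine le_trans ?_ (hS.matches_often Q hQ j i hi)
  have hp := availProb_nonneg d S Q i j
  have hu := unusedProb_nonneg d S Q i j
  rw [guarantee]
  split_ifs <;> linarith

theorem offlineGain_nonneg (hS : IsOCR d (1 / 32) S) (hQ : ∀ j, (Q j).card ≤ 2) (i : V) (t : ℕ) :
    0 ≤ offlineGain d S Q i t := by
  rw [offlineGain]
  split_ifs with hi
  · have h := half_availProb_le hS hQ hi
    have hp := availProb_nonneg d S Q i t
    have hu := unusedProb_nonneg d S Q i t
    rw [returnProb]
    linarith
  · exact le_rfl

theorem dualGain_empty (j : ℕ) : dualGain d (1 / 32) (50 / 99) (48 / 99) S Q j ∅ = 0 :=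
  Finset.sum_empty

theorem dualGain_singleton (i : V) (j : ℕ) :
    dualGain d (1 / 32) (50 / 99) (48 / 99) S Q j {i} =
      (49 * availProb d S Q i j - unusedProb d S Q i j) / 99 := by
  rw [dualGain, Finset.sum_singleton, Finset.card_singleton, guarantee, if_pos rfl, returnProb]
  ring

theorem dualGain_pair {i k : V} (h : i ≠ k) (j : ℕ) :
    dualGain d (1 / 32) (50 / 99) (48 / 99) S Q j {i, k} =
      (50 * availProb d S Q i j + unusedProb d S Q i j) / 198 +
        (50 * availProb d S Q k j + unusedProb d S Q k j) / 198 := by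
  rw [dualGain, Finset.sum_pair h, Finset.card_pair h, guarantee, guarantee, if_neg (by decide),
    if_neg (by decide), returnProb, returnProb]
  ring

/-- If the neighbour `i` is left out of an optimal proposal, replacing a proposed vertex by `i`, or
adding `i`, is no improvement.  Hence the dual variable is at least twice what `i` would contribute
to a proposal of two vertices; if one vertex is proposed, this uses that its contribution to a pair
is at least half of its value as a singleton. -/
theorem le_dualGain_of_notMem {nbrs R : Finset V} {i : V} {j : ℕ} (hi : i ∈ nbrs) (hiR : i ∉ R)
    (hR : R ⊆ nbrs) (hcard : R.card ≤ 2) (hr : 0 ≤ returnProb d S Q i j)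
    (hmax : ∀ R' ⊆ nbrs, R'.card ≤ 2 → dualGain d (1 / 32) (50 / 99) (48 / 99) S Q j R' ≤
      dualGain d (1 / 32) (50 / 99) (48 / 99) S Q j R) :
    (50 * availProb d S Q i j + unusedProb d S Q i j) / 99 ≤
      dualGain d (1 / 32) (50 / 99) (48 / 99) S Q j R := by
  have hu := unusedProb_nonneg d S Q i j
  rw [returnProb] at hr
  have hpair : ∀ k ∈ R, dualGain d (1 / 32) (50 / 99) (48 / 99) S Q j {i, k} ≤
      dualGain d (1 / 32) (50 / 99) (48 / 99) S Q j R := fun k hk =>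
    hmax _ (Finset.insert_subset hi (Finset.singleton_subset_iff.2 (hR hk))) Finset.card_le_two
  obtain h | h | h : R.card = 0 ∨ R.card = 1 ∨ R.card = 2 := by omega
  · have h1 := hmax {i} (Finset.singleton_subset_iff.2 hi) (by simp)
    rw [Finset.card_eq_zero] at h
    subst h
    rw [dualGain_singleton, dualGain_empty] at h1
    rw [dualGain_empty]
    linarith
  · obtain ⟨k, rfl⟩ := Finset.card_eq_one.1 h
    have h1 := hpair k (by simp)
    have hik : i ≠ k := fun h => hiR (by simp [h])
    have huk := unusedProb_nonneg d S Q k j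
    have hpk := availProb_nonneg d S Q k j
    rw [dualGain_pair hik, dualGain_singleton] at h1
    rw [dualGain_singleton]
    linarith
  · obtain ⟨k, l, hkl, rfl⟩ := Finset.card_eq_two.1 h
    have h1 := hpair k (by simp)
    have h2 := hpair l (by simp)
    have hik : i ≠ k := fun h => hiR (by simp [h])
    have hil : i ≠ l := fun h => hiR (by simp [h])
    rw [dualGain_pair hik, dualGain_pair hkl] at h1
    rw [dualGain_pair hil, dualGain_pair hkl] at h2
    rw [dualGain_pair hkl]
    linarith

/-- Approximate dual feasibility: along every edge `(i, j)`, the dual variable of `j` and what `i`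
gained in the rounds `j - d + 1, …, j` add up to the competitive ratio. -/
theorem dual_feasible (hd : 1 ≤ d) (hS : IsOCR d (1 / 32) S) (hQ : ∀ j, (Q j).card ≤ 2)
    {nbrs : Finset V} {j : ℕ} (hsub : Q j ⊆ nbrs)
    (hmax : ∀ R ⊆ nbrs, R.card ≤ 2 → dualGain d (1 / 32) (50 / 99) (48 / 99) S Q j R ≤
      dualGain d (1 / 32) (50 / 99) (48 / 99) S Q j (Q j)) {i : V} (hi : i ∈ nbrs) :
    50 / 99 ≤ dualGain d (1 / 32) (50 / 99) (48 / 99) S Q j (Q j) +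
      ∑ t ∈ (Finset.range (j + 1)).filter (fun t => j < t + d), offlineGain d S Q i t := by
  have hr := returnProb_nonneg hS hQ i j
  have hsum := sum_returnProb_le hS hQ i (le_refl j)
  have hp : availProb d S Q i j = 1 - ∑ t ∈ (Finset.range j).filter (fun t => j < t + d),
    matchProb d S Q i t := rfl
  have hgain : ∀ t, offlineGain d S Q i t = 51 / 99 * matchProb d S Q i t -
      1 / 99 * (if i ∈ Q t then returnProb d S Q i t else 0) := by
    intro t
    rw [offlineGain]
    split_ifs with hit
    · ring
    · rw [matchProb_eq_zero hS hQ hit]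
      ring
  have hpast : ∑ t ∈ (Finset.range j).filter (fun t => j < t + d), offlineGain d S Q i t =
      51 / 99 * ∑ t ∈ (Finset.range j).filter (fun t => j < t + d), matchProb d S Q i t -
      1 / 99 * ∑ t ∈ (Finset.range j).filter (fun t => j < t + d),
        (if i ∈ Q t then returnProb d S Q i t else 0) := by
    rw [Finset.mul_sum, Finset.mul_sum, ← Finset.sum_sub_distrib]
    exact Finset.sum_congr rfl fun t _ => hgain t
  rw [Finset.range_add_one, Finset.filter_insert, if_pos (by omega), Finset.sum_insert (by simp),
    hpast]
  by_cases hiQ : i ∈ Q j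
  · have h1 := hmax {i} (Finset.singleton_subset_iff.2 hi) (by simp)
    have h2 := half_availProb_le hS hQ hiQ
    rw [dualGain_singleton] at h1
    rw [hgain j, if_pos hiQ, returnProb]
    rw [returnProb] at hr
    have hu := unusedProb_nonneg d S Q i j
    linarith
  · have h1 := le_dualGain_of_notMem hi hiQ hsub (hQ j) hr hmax
    rw [hgain j, if_neg hiQ, matchProb_eq_zero hS hQ hiQ]
    linarith

/-- The windows of `d` rounds that end when a feasible matching uses `i` are disjoint. -/
theorem sum_windows_le {N : ℕ → Finset V} {n : ℕ} {M : ℕ → Option V} (hM : IsFeasible d N n M)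
    (i : V) {g : ℕ → ℝ} (hg : ∀ t, 0 ≤ g t) :
    ∑ j ∈ (Finset.range n).filter (fun j => M j = some i),
      ∑ t ∈ (Finset.range (j + 1)).filter (fun t => j < t + d), g t ≤
        ∑ t ∈ Finset.range n, g t := by
  rw [← Finset.sum_biUnion]
  · refine Finset.sum_le_sum_of_subset_of_nonneg (fun t ht => ?_) fun t _ _ => hg t
    simp only [Finset.mem_biUnion, Finset.mem_filter, Finset.mem_range] at ht ⊢
    obtain ⟨j, hj, ht⟩ := ht
    omega
  · have key : ∀ j < n, ∀ k < j, M j = some i → M k = some i → k + d ≤ j := fun j hj k hk h h' =>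
      (hM j hj i h).2 k hk h'
    intro j hj k hk hjk
    simp only [Finset.coe_filter, Finset.mem_range, Set.mem_ofPred_eq] at hj hk
    refine Finset.disjoint_left.2 fun t ht ht' => ?_
    rw [Finset.mem_filter, Finset.mem_range] at ht ht'
    rcases lt_or_gt_of_ne hjk with h | h
    · have := key k hk.1 j h hk.2 hj.2
      omega
    · have := key j hj.1 k h hj.2 hk.2
      omega

/-- Weak duality, and the fact that the dual objective is at most the expected size. -/
theorem size_le_sum_matchProb [Fintype V] (hd : 1 ≤ d) (hS : IsOCR d (1 / 32) S)
    (hQ : ∀ j, (Q j).card ≤ 2) {N : ℕ → Finset V} (hsub : ∀ j, Q j ⊆ N j)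
    (hmax : ∀ j, ∀ R ⊆ N j, R.card ≤ 2 → dualGain d (1 / 32) (50 / 99) (48 / 99) S Q j R ≤
      dualGain d (1 / 32) (50 / 99) (48 / 99) S Q j (Q j))
    {n : ℕ} {M : ℕ → Option V} (hM : IsFeasible d N n M) :
    50 / 99 * (size n M : ℝ) ≤ ∑ j ∈ Finset.range n, ∑ i ∈ Q j, matchProb d S Q i j := by
  set b : ℕ → ℝ := fun j => dualGain d (1 / 32) (50 / 99) (48 / 99) S Q j (Q j) with hb
  have hb0 : ∀ j, 0 ≤ b j := fun j => by
    have := hmax j ∅ (Finset.empty_subset _) (by simp)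
    rwa [dualGain_empty] at this
  have hpart : ∀ j, b j + ∑ i, offlineGain d S Q i j ≤ ∑ i ∈ Q j, matchProb d S Q i j := by
    intro j
    simp only [offlineGain]
    rw [Finset.sum_ite_mem, Finset.univ_inter, hb]
    simp only [dualGain]
    rw [← Finset.sum_add_distrib]
    refine Finset.sum_le_sum fun i hi => ?_
    -- The dual objective uses the guaranteed instead of the actual matching probability.
    have := hS.matches_often Q hQ j i hi
    linarith
  have hedge : ∀ j ∈ Finset.range n, (if (M j).isSome = true then (50 / 99 : ℝ) else 0) ≤ b j +
      ∑ i, if M j = some i then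
        ∑ t ∈ (Finset.range (j + 1)).filter (fun t => j < t + d), offlineGain d S Q i t else 0 := by
    intro j hj
    cases hMj : M j with
    | none => simpa using hb0 j
    | some i =>
      have hi := (hM j (Finset.mem_range.1 hj) i hMj).1
      simpa only [Option.isSome_some, if_true, Option.some.injEq, Finset.sum_ite_eq,
        Finset.mem_univ] using dual_feasible hd hS hQ (hsub j) (hmax j) hi
  calc 50 / 99 * (size n M : ℝ)
      = ∑ j ∈ Finset.range n, if (M j).isSome = true then (50 / 99 : ℝ) else 0 := by
        rw [size, ← Finset.sum_filter, Finset.sum_const, nsmul_eq_mul, mul_comm]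
    _ ≤ ∑ j ∈ Finset.range n, (b j + ∑ i, if M j = some i then
          ∑ t ∈ (Finset.range (j + 1)).filter (fun t => j < t + d), offlineGain d S Q i t
          else 0) := Finset.sum_le_sum hedge
    _ = ∑ j ∈ Finset.range n, b j + ∑ i, ∑ j ∈ (Finset.range n).filter (fun j => M j = some i),
          ∑ t ∈ (Finset.range (j + 1)).filter (fun t => j < t + d), offlineGain d S Q i t := by
        rw [Finset.sum_add_distrib, Finset.sum_comm]
        simp only [Finset.sum_filter]
    _ ≤ ∑ j ∈ Finset.range n, b j + ∑ i, ∑ t ∈ Finset.range n, offlineGain d S Q i t := by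
        gcongr with i
        exact sum_windows_le hM i (offlineGain_nonneg hS hQ i)
    _ = ∑ j ∈ Finset.range n, (b j + ∑ i, offlineGain d S Q i j) := by
        rw [Finset.sum_comm, Finset.sum_add_distrib]
    _ ≤ _ := Finset.sum_le_sum fun j _ => hpart j

theorem twoLayer_isCompetitive [Fintype V] (hd : 1 ≤ d) (hS : IsOCR d (1 / 32) S)
    {rule : ProposalRule V} (hrule : IsPrimalDualRule d (1 / 32) (50 / 99) (48 / 99) S rule) :
    (twoLayer d S rule).IsCompetitive d (50 / 99) := by
  have hcard : ∀ N j, (proposals rule N j).card ≤ 2 := fun N j => (hrule _ _ _).2.1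
  have hsub : ∀ N j, proposals rule N j ⊆ N j := fun N j => (hrule _ _ _).1
  refine ⟨fun N n M hM => twoLayer_feasible hS (hcard N) (hsub N) n hM, fun N n => ?_⟩
  obtain ⟨M, hM, hsize⟩ := (opt_isGreatest d N n).1
  rw [twoLayer_expectedSize hS (hcard N), ← hsize, ← ENNReal.ofReal_natCast,
    ← ENNReal.ofReal_mul (by norm_num)]
  refine ENNReal.ofReal_le_ofReal (size_le_sum_matchProb hd hS (hcard N) (hsub N) ?_ hM)
  intro j R hR hR2
  have h := (hrule j (history rule N j) (N j)).2.2 R hR hR2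
  have hc : ∀ R, dualGain d (1 / 32) (50 / 99) (48 / 99) S (history rule N j) j R =
      dualGain d (1 / 32) (50 / 99) (48 / 99) S (proposals rule N) j R := fun R =>
    dualGain_congr d S (fun t ht => history_of_lt rule N ht) _ _ _ R
  rwa [hc, hc] at h

theorem exists_isPrimalDualRule (d : ℕ) (γ β₁ β₂ : ℝ) (S : OnlineProcedure V) :
    ∃ rule : ProposalRule V, IsPrimalDualRule d γ β₁ β₂ S rule := by
  have h : ∀ (j : ℕ) (Q : ℕ → Finset V) (nbrs : Finset V), ∃ R', R' ⊆ nbrs ∧ R'.card ≤ 2 ∧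
      ∀ R ⊆ nbrs, R.card ≤ 2 → dualGain d γ β₁ β₂ S Q j R ≤ dualGain d γ β₁ β₂ S Q j R' := by
    intro j Q nbrs
    obtain ⟨R', hR', hmax⟩ := Finset.exists_max_image
      (nbrs.powerset.filter fun R => R.card ≤ 2) (dualGain d γ β₁ β₂ S Q j) ⟨∅, by simp⟩
    rw [Finset.mem_filter, Finset.mem_powerset] at hR'
    exact ⟨R', hR'.1, hR'.2, fun R hR hR2 =>
      hmax R (Finset.mem_filter.2 ⟨Finset.mem_powerset.2 hR, hR2⟩)⟩
  choose rule hrule using h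
  exact ⟨rule, hrule⟩

end Dual

/-! ### One round of the inner algorithm -/

section InnerRound

variable {V : Type u} [DecidableEq V]

theorem two_mul_mean_coin (f : Bool → ℝ≥0∞) : 2 * mean coin f = f true + f false := by
  have h : ∀ b, coin b = 2⁻¹ := fun b => by simp [coin]
  rw [mean, tsum_bool, h, h, ← mul_add, ← mul_assoc,
    ENNReal.mul_inv_cancel two_ne_zero ENNReal.ofNat_ne_top, one_mul, add_comm]

theorem coin_bind_not {α : Type*} (q : Bool → PMF α) : (coin.bind fun b => q !b) = coin.bind q := by
  have h : ∀ b, coin b = 2⁻¹ := fun b => by simp [coin]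
  ext a
  simp only [PMF.bind_apply, tsum_bool, h, Bool.not_true, Bool.not_false]
  exact add_comm _ _

theorem assign_comm (d j : ℕ) (i k : V) (s : Status.{u}) (τ : V → ℕ → Status.{u}) :
    assign d j i s (assign d j k s τ) = assign d j k s (assign d j i s τ) := by
  ext v t
  simp only [assign]
  split_ifs <;> rfl

theorem senderRound_comm (d j : ℕ) (i k : V) (τ : V → ℕ → Status.{u}) :
    senderRound d j i k τ = senderRound d j k i τ := by
  rw [senderRound, ← coin_bind_not, senderRound]
  congr 1
  ext1 ℓ
  rw [← coin_bind_not]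
  congr 1
  ext1 m
  cases ℓ <;> cases m <;> rfl

theorem receiverRound_comm (d j : ℕ) (i k : V) (τ : V → ℕ → Status.{u}) :
    receiverRound d j i k τ = receiverRound d j k i τ := by
  rw [receiverRound, ← coin_bind_not, receiverRound]
  congr 1
  ext1 m
  rw [assign_comm d j k i]
  have h : (cond (!m) i k) = cond m k i := by cases m <;> rfl
  rw [h]
  cases τ (cond m k i) j
  · simp only
    rw [← coin_bind_not]
    congr 1
    ext1 ℓ
    cases ℓ <;> rfl
  · simp only [PMF.pure_bind]
    cases m <;> rfl
  · simp only [PMF.pure_bind]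
    cases m <;> rfl

theorem innerRound_empty (d j : ℕ) (τ : V → ℕ → Status.{u}) :
    innerRound d j ∅ τ = PMF.pure (none, τ) := by
  rw [innerRound, Finset.toList_empty]

theorem innerRound_singleton (d j : ℕ) (i : V) (τ : V → ℕ → Status.{u}) :
    innerRound d j {i} τ = PMF.pure (some i, assign d j i Status.unknown τ) := by
  rw [innerRound, Finset.toList_singleton]

/-- The law of a round does not depend on the order in which a pair is enumerated. -/
theorem innerRound_pair (d j : ℕ) {i k : V} (h : i ≠ k) (τ : V → ℕ → Status.{u}) :
    innerRound d j {i, k} τ = coin.bind fun b =>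
      if b = true then senderRound d j i k τ else receiverRound d j i k τ := by
  have hlen : ({i, k} : Finset V).toList.length = 2 := by
    rw [Finset.length_toList, Finset.card_pair h]
  obtain ⟨a, b, hab⟩ := List.length_eq_two.1 hlen
  have hmem : ∀ x, x ∈ [a, b] ↔ x = i ∨ x = k := fun x => by
    rw [← hab, Finset.mem_toList, Finset.mem_insert, Finset.mem_singleton]
  have ha := (hmem a).1 (by simp)
  have hb := (hmem b).1 (by simp)
  have hne : a ≠ b := by
    have := ({i, k} : Finset V).nodup_toList
    rw [hab] at this
    simpa using this
  rw [innerRound, hab]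
  rcases ha with rfl | rfl <;> rcases hb with rfl | rfl
  · exact absurd rfl hne
  · rfl
  · simp only [senderRound_comm d j a, receiverRound_comm d j a]
  · exact absurd rfl hne

/-- The outcome of a sender round with the bits `ℓ` and `m`. -/
def senderOutcome (d j : ℕ) (i k : V) (τ : V → ℕ → Status.{u}) (ℓ m : Bool) :
    Option V × (V → ℕ → Status.{u}) :=
  (some (cond ℓ i k),
    assign d j (cond m i k) (if m = ℓ then Status.selected else Status.notSelected)
      (assign d j (cond m k i) Status.unknown τ))

/-- The outcome of a receiver round that selects according to the bit `ℓ`. -/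
def receiverOutcome (d j : ℕ) (i k : V) (τ : V → ℕ → Status.{u}) (ℓ : Bool) :
    Option V × (V → ℕ → Status.{u}) :=
  (some (cond ℓ i k), assign d j k Status.unknown (assign d j i Status.unknown τ))

/-- The law of the bit that a receiver round selects by, if it consults the status `x` of the vertex
given by the bit `m`. -/
noncomputable def receiverBit (m : Bool) : Status.{u} → PMF Bool
  | Status.selected => PMF.pure !m
  | Status.notSelected => PMF.pure m
  | Status.unknown => coin

theorem eight_mul_mean_pair (d j : ℕ) {i k : V} (h : i ≠ k) (τ : V → ℕ → Status.{u})
    (f : Option V × (V → ℕ → Status.{u}) → ℝ≥0∞) :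
    8 * mean (innerRound d j {i, k} τ) f =
      f (senderOutcome d j i k τ true true) + f (senderOutcome d j i k τ true false) +
        f (senderOutcome d j i k τ false true) + f (senderOutcome d j i k τ false false) +
      (2 * mean (receiverBit true (τ i j)) (fun ℓ => f (receiverOutcome d j i k τ ℓ)) +
        2 * mean (receiverBit false (τ k j)) (fun ℓ => f (receiverOutcome d j i k τ ℓ))) := by
  have hs : 2 * (2 * mean (senderRound d j i k τ) f) =
      f (senderOutcome d j i k τ true true) + f (senderOutcome d j i k τ true false) +
        f (senderOutcome d j i k τ false true) + f (senderOutcome d j i k τ false false) := by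
    rw [senderRound, mean_bind, two_mul_mean_coin, mul_add, mean_bind, mean_bind, two_mul_mean_coin,
      two_mul_mean_coin, add_assoc (_ + _)]
    simp only [mean_pure, senderOutcome]
  have hr : 2 * mean (receiverRound d j i k τ) f =
      mean (receiverBit true (τ i j)) (fun ℓ => f (receiverOutcome d j i k τ ℓ)) +
        mean (receiverBit false (τ k j)) (fun ℓ => f (receiverOutcome d j i k τ ℓ)) := by
    rw [receiverRound, mean_bind, two_mul_mean_coin, mean_bind, mean_bind]
    simp only [mean_pure]
    rfl
  rw [innerRound_pair d j h, mean_bind, ← hs, ← mul_add 2 (mean _ _), ← hr,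
    show (8 : ℝ≥0∞) = 2 * 2 * 2 by norm_num, mul_assoc, two_mul_mean_coin]
  simp only [if_true, Bool.false_eq_true, if_false]
  ring

/-- A round with two proposed vertices selects each of them with probability `1 / 2`, up to a
correction of `1 / 8` for each recorded status that it may consult. -/
theorem eight_mul_mean_select (d j : ℕ) {i k : V} (h : i ≠ k) (τ : V → ℕ → Status.{u}) :
    8 * mean (innerRound d j {i, k} τ) (fun r => ind (r.1 = some i)) +
        ind (τ i j = Status.selected) + ind (τ k j = Status.notSelected) =
      4 + ind (τ i j = Status.notSelected) + ind (τ k j = Status.selected) := by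
  rw [eight_mul_mean_pair d j h]
  have hki := h.symm
  cases τ i j <;> cases τ k j <;>
    simp only [receiverBit, two_mul_mean_coin, mean_pure, senderOutcome, receiverOutcome, ind,
      cond_true, cond_false, Option.some.injEq, hki, reduceCtorEq, if_true, if_false, Bool.not_true,
      Bool.not_false] <;> norm_num

theorem mem_support_innerRound_pair {d j : ℕ} {i k : V} (h : i ≠ k) {τ : V → ℕ → Status.{u}}
    {r : Option V × (V → ℕ → Status.{u})} (hr : r ∈ (innerRound d j {i, k} τ).support) :
    (∃ ℓ m, r = senderOutcome d j i k τ ℓ m) ∨ ∃ ℓ, r = receiverOutcome d j i k τ ℓ := by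
  rw [innerRound_pair d j h, PMF.mem_support_bind_iff] at hr
  obtain ⟨b, -, hr⟩ := hr
  cases b
  · rw [if_neg Bool.false_ne_true, receiverRound, PMF.mem_support_bind_iff] at hr
    obtain ⟨m, -, hr⟩ := hr
    rw [PMF.mem_support_bind_iff] at hr
    obtain ⟨ℓ, -, hr⟩ := hr
    rw [PMF.mem_support_pure_iff] at hr
    exact Or.inr ⟨ℓ, hr⟩
  · rw [if_pos rfl, senderRound, PMF.mem_support_bind_iff] at hr
    obtain ⟨ℓ, -, hr⟩ := hr
    rw [PMF.mem_support_bind_iff] at hr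
    obtain ⟨m, -, hr⟩ := hr
    rw [PMF.mem_support_pure_iff] at hr
    exact Or.inl ⟨ℓ, m, hr⟩

theorem innerRound_selects {d j : ℕ} {Q : Finset V} (hQ : Q.card ≤ 2) {τ : V → ℕ → Status.{u}}
    {r : Option V × (V → ℕ → Status.{u})} (hr : r ∈ (innerRound d j Q τ).support) :
    (∀ i, r.1 = some i → i ∈ Q) ∧ (Q.Nonempty → r.1 ≠ none) := by
  obtain h | h | h : Q.card = 0 ∨ Q.card = 1 ∨ Q.card = 2 := by omega
  · rw [Finset.card_eq_zero] at h
    subst h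
    rw [innerRound_empty, PMF.mem_support_pure_iff] at hr
    simp [hr]
  · obtain ⟨i, rfl⟩ := Finset.card_eq_one.1 h
    rw [innerRound_singleton, PMF.mem_support_pure_iff] at hr
    simp [hr]
  · obtain ⟨i, k, hik, rfl⟩ := Finset.card_eq_two.1 h
    rcases mem_support_innerRound_pair hik hr with ⟨ℓ, m, rfl⟩ | ⟨ℓ, rfl⟩ <;> cases ℓ <;>
      simp [senderOutcome, receiverOutcome]

/-- A round leaves the statuses of the vertices that are not proposed as they are, and gives each
proposed vertex one status for the next `d - 1` rounds.  This status, if known, is correct. -/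
theorem innerRound_status {d j : ℕ} {Q : Finset V} (hQ : Q.card ≤ 2) {τ : V → ℕ → Status.{u}}
    {r : Option V × (V → ℕ → Status.{u})} (hr : r ∈ (innerRound d j Q τ).support) :
    (∀ v ∉ Q, r.2 v = τ v) ∧ ∀ v ∈ Q, ∃ x : Status.{u},
      (∀ t, r.2 v t = if j < t ∧ t < j + d then x else τ v t) ∧
        (x ≠ Status.unknown → Q.card = 2 ∧ (r.1 = some v ↔ x = Status.selected)) := by
  obtain h | h | h : Q.card = 0 ∨ Q.card = 1 ∨ Q.card = 2 := by omega
  · rw [Finset.card_eq_zero] at h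
    subst h
    rw [innerRound_empty, PMF.mem_support_pure_iff] at hr
    simp [hr]
  · obtain ⟨i, rfl⟩ := Finset.card_eq_one.1 h
    rw [innerRound_singleton, PMF.mem_support_pure_iff] at hr
    subst hr
    refine ⟨fun v hv => ?_, fun v hv => ⟨Status.unknown, fun t => ?_, fun hx => absurd rfl hx⟩⟩
    · ext t
      rw [Finset.mem_singleton] at hv
      simp [assign, hv]
    · rw [Finset.mem_singleton] at hv
      simp [assign, hv]
  · obtain ⟨i, k, hik, rfl⟩ := Finset.card_eq_two.1 h
    have hki := hik.symm
    rcases mem_support_innerRound_pair hik hr with ⟨ℓ, m, rfl⟩ | ⟨ℓ, rfl⟩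
    · refine ⟨fun v hv => ?_, fun v hv => ?_⟩
      · rw [Finset.mem_insert, Finset.mem_singleton, not_or] at hv
        ext t
        cases m <;> simp [senderOutcome, assign, hv.1, hv.2]
      · rw [Finset.mem_insert, Finset.mem_singleton] at hv
        by_cases hm : v = cond m i k
        · refine ⟨if m = ℓ then Status.selected else Status.notSelected, fun t => ?_, fun _ => ?_⟩
          · cases m <;> simp_all [senderOutcome, assign]
          · refine ⟨h, ?_⟩
            cases m <;> cases ℓ <;> simp_all [senderOutcome]
        · refine ⟨Status.unknown, fun t => ?_, fun hx => absurd rfl hx⟩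
          cases m <;> simp_all [senderOutcome, assign]
    · refine ⟨fun v hv => ?_, fun v hv => ⟨Status.unknown, fun t => ?_, fun hx => absurd rfl hx⟩⟩
      · rw [Finset.mem_insert, Finset.mem_singleton, not_or] at hv
        ext t
        simp [receiverOutcome, assign, hv.1, hv.2]
      · rw [Finset.mem_insert, Finset.mem_singleton] at hv
        rcases hv with rfl | rfl <;> simp [receiverOutcome, assign] <;> grind

end InnerRound

/-! ### The symmetry between the two known statuses -/

section Flip

variable {V : Type u} [DecidableEq V]

/-- The exchange of `selected` and `notSelected`. -/
def Status.flip : Status.{u} → Status.{u}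
  | Status.unknown => Status.unknown
  | Status.selected => Status.notSelected
  | Status.notSelected => Status.selected

/-- The exchange of `selected` and `notSelected` in the statuses assigned to `v` in round `s`. -/
def flipStatus (d s : ℕ) (v : V) (τ : V → ℕ → Status.{u}) : V → ℕ → Status.{u} :=
  fun w t => if w = v ∧ s < t ∧ t < s + d then (τ w t).flip else τ w t

/-- The selection from the proposal `{v, k}` after the status `x` of `v`, if known, has been
exchanged. -/
def swapSelection (v k : V) (sel : Option V) : Status.{u} → Option V
  | Status.unknown => sel
  | Status.selected => some k
  | Status.notSelected => some v

theorem flipStatus_assign_self (d s : ℕ) (v : V) (x : Status.{u}) (τ : V → ℕ → Status.{u}) :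
    flipStatus d s v (assign d s v x τ) = assign d s v x.flip τ := by
  ext w t
  simp only [flipStatus, assign]
  split_ifs <;> rfl

theorem flipStatus_assign_of_ne (d s n : ℕ) {v w : V} (h : w ≠ v) (x : Status.{u})
    (τ : V → ℕ → Status.{u}) :
    flipStatus d s v (assign d n w x τ) = assign d n w x (flipStatus d s v τ) := by
  ext y t
  by_cases hy : y = v
  · subst hy
    simp [flipStatus, assign, h.symm]
  · simp [flipStatus, assign, hy]

theorem flipStatus_apply_of_ne (d s : ℕ) {v w : V} (h : w ≠ v) (τ : V → ℕ → Status.{u}) :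
    flipStatus d s v τ w = τ w := by
  ext t
  simp [flipStatus, h]

theorem assign_comm_of_ne (d j : ℕ) {i k : V} (h : i ≠ k) (x y : Status.{u})
    (τ : V → ℕ → Status.{u}) :
    assign d j i x (assign d j k y τ) = assign d j k y (assign d j i x τ) := by
  ext v t
  by_cases hv : v = i
  · subst hv
    simp [assign, h]
  · simp [assign, hv]

/-- Exchanging the known status of `v`, together with the selection, preserves the law of a round in
which `v` is proposed: this exchanges the two values of `ℓ` in a sender round that picks `v`. -/
theorem mean_innerRound_swap {d s j : ℕ} (hsj : s < j) (hj : j < s + d) {v k : V} (h : v ≠ k)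
    (τ : V → ℕ → Status.{u}) (f : Option V × (V → ℕ → Status.{u}) → ℝ≥0∞) :
    mean (innerRound d s {v, k} τ)
        (fun r => f (swapSelection v k r.1 (r.2 v j), flipStatus d s v r.2)) =
      mean (innerRound d s {v, k} τ) f := by
  rw [← ENNReal.mul_right_inj (a := 8) (by norm_num) (by norm_num), eight_mul_mean_pair d s h,
    eight_mul_mean_pair d s h]
  have hu : ∀ (x : Option V) (y : Status.{u}) (τ' : V → ℕ → Status.{u}),
      (swapSelection v k x (assign d s v y τ' v j), flipStatus d s v (assign d s v y τ')) =
        (swapSelection v k x y, assign d s v y.flip τ') := by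
    intro x y τ'
    rw [flipStatus_assign_self]
    simp [assign, hsj, hj]
  simp only [senderOutcome, receiverOutcome, cond_true, cond_false, if_true, reduceCtorEq, if_false,
    assign_comm_of_ne d s h.symm, hu]
  simp only [Status.flip, swapSelection]
  ring

/-- The exchange does not affect a round in which `v` is not proposed. -/
theorem innerRound_flipStatus (d s n : ℕ) {v : V} {Q : Finset V} (hQ : Q.card ≤ 2) (hv : v ∉ Q)
    (τ : V → ℕ → Status.{u}) :
    innerRound d n Q (flipStatus d s v τ) =
      (innerRound d n Q τ).map fun r => (r.1, flipStatus d s v r.2) := by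
  obtain h | h | h : Q.card = 0 ∨ Q.card = 1 ∨ Q.card = 2 := by omega
  · rw [Finset.card_eq_zero] at h
    subst h
    rw [innerRound_empty, innerRound_empty, PMF.pure_map]
  · obtain ⟨i, rfl⟩ := Finset.card_eq_one.1 h
    have hiv : i ≠ v := fun h => hv (by simp [h])
    rw [innerRound_singleton, innerRound_singleton, PMF.pure_map, flipStatus_assign_of_ne d s n hiv]
  · obtain ⟨i, k, hik, rfl⟩ := Finset.card_eq_two.1 h
    have hiv : i ≠ v := fun h => hv (by simp [h])
    have hkv : k ≠ v := fun h => hv (by simp [h])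
    have hc : ∀ m, cond m i k ≠ v := fun m => by cases m <;> assumption
    have hc' : ∀ m, cond m k i ≠ v := fun m => by cases m <;> assumption
    rw [innerRound_pair d n hik, innerRound_pair d n hik, PMF.map_bind]
    congr 1
    ext1 b
    cases b
    · rw [if_neg Bool.false_ne_true, if_neg Bool.false_ne_true, receiverRound, receiverRound,
        PMF.map_bind]
      simp only [PMF.map_bind, PMF.pure_map, flipStatus_assign_of_ne d s n hkv,
        flipStatus_assign_of_ne d s n hiv, flipStatus_apply_of_ne d s (hc _)]
    · rw [if_pos rfl, if_pos rfl, senderRound, senderRound]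
      simp only [PMF.map_bind, PMF.pure_map, flipStatus_assign_of_ne d s n (hc _),
        flipStatus_assign_of_ne d s n (hc' _)]

end Flip

/-! ### Runs of the inner algorithm -/

section InnerRun

variable {V : Type u} [DecidableEq V]

theorem exists_eq_pair {R : Finset V} (hR : R.card = 2) {v : V} (hv : v ∈ R) :
    ∃ k, v ≠ k ∧ R = {v, k} := by
  obtain ⟨a, b, hab, rfl⟩ := Finset.card_eq_two.1 hR
  rw [Finset.mem_insert, Finset.mem_singleton] at hv
  rcases hv with rfl | rfl
  · exact ⟨b, hab, rfl⟩
  · exact ⟨a, hab.symm, Finset.pair_comm a v⟩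

theorem eq_singleton_or_exists_eq_pair {R : Finset V} (hR : R.card ≤ 2) {v : V} (hv : v ∈ R) :
    R = {v} ∨ ∃ k, v ≠ k ∧ R = {v, k} := by
  have h0 : 0 < R.card := Finset.card_pos.2 ⟨v, hv⟩
  obtain h | h : R.card = 1 ∨ R.card = 2 := by omega
  · obtain ⟨a, rfl⟩ := Finset.card_eq_one.1 h
    rw [Finset.mem_singleton.1 hv]
    exact Or.inl rfl
  · exact Or.inr (exists_eq_pair h hv)

/-- The joint law of the first `n` selections and of the statuses after `n` rounds. -/
noncomputable def innerRun (d : ℕ) (Q : ℕ → Finset V) :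
    ℕ → PMF ((ℕ → Option V) × (V → ℕ → Status.{u}))
  | 0 => PMF.pure (fun _ => none, fun _ _ => Status.unknown)
  | n + 1 => (innerRun d Q n).bind fun ω =>
      (innerRound d n (Q n) ω.2).map fun r => (Function.update ω.1 n r.1, r.2)

variable (d : ℕ) (Q : ℕ → Finset V)

theorem innerAlgorithm_run (n : ℕ) :
    (innerAlgorithm V d).run Q n = (innerRun d Q n).map fun ω => (ω.1, (n, ω.2)) := by
  induction n with
  | zero =>
    rw [OnlineProcedure.run, innerRun, PMF.pure_map]
    rfl
  | succ n ih =>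
    rw [OnlineProcedure.run, ih, innerRun, PMF.map_bind]
    -- The type of states of `innerAlgorithm V d` has to be unfolded here.
    erw [PMF.bind_map]
    congr 1
    ext1 ω
    simp only [Function.comp_apply, innerAlgorithm, PMF.map_comp]
    rfl

theorem innerAlgorithm_outputs (n : ℕ) :
    (innerAlgorithm V d).outputs Q n = (innerRun d Q n).map Prod.fst := by
  rw [OnlineProcedure.outputs, innerAlgorithm_run]
  exact PMF.map_comp _ _ _

theorem mean_innerAlgorithm_outputs (n : ℕ) (f : (ℕ → Option V) → ℝ≥0∞) :
    mean ((innerAlgorithm V d).outputs Q n) f = mean (innerRun d Q n) fun ω => f ω.1 := by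
  rw [innerAlgorithm_outputs, mean_map]

theorem mean_innerRun_succ (n : ℕ) (f : (ℕ → Option V) × (V → ℕ → Status.{u}) → ℝ≥0∞) :
    mean (innerRun d Q (n + 1)) f = mean (innerRun d Q n) fun ω =>
      mean (innerRound d n (Q n) ω.2) fun r => f (Function.update ω.1 n r.1, r.2) := by
  rw [innerRun, mean_bind]
  simp only [mean_map]

theorem mem_support_innerRun_succ {n : ℕ} {ω : (ℕ → Option V) × (V → ℕ → Status.{u})}
    (h : ω ∈ (innerRun d Q (n + 1)).support) : ∃ ω' ∈ (innerRun d Q n).support,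
      ∃ r ∈ (innerRound d n (Q n) ω'.2).support, ω = (Function.update ω'.1 n r.1, r.2) := by
  rw [innerRun, PMF.mem_support_bind_iff] at h
  obtain ⟨ω', hω', h⟩ := h
  rw [PMF.mem_support_map_iff] at h
  obtain ⟨r, hr, rfl⟩ := h
  exact ⟨ω', hω', r, hr, rfl⟩

variable {Q}

theorem innerRun_selects (hQ : ∀ j, (Q j).card ≤ 2) {n : ℕ}
    {ω : (ℕ → Option V) × (V → ℕ → Status.{u})}
    (h : ω ∈ (innerRun d Q n).support) {j : ℕ} (hj : j < n) :
    (∀ i, ω.1 j = some i → i ∈ Q j) ∧ ((Q j).Nonempty → ω.1 j ≠ none) := by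
  induction n generalizing ω with
  | zero => exact absurd hj (Nat.not_lt_zero j)
  | succ n ih =>
    obtain ⟨ω', hω', r, hr, rfl⟩ := mem_support_innerRun_succ d Q h
    rcases (Nat.lt_succ_iff.1 hj).eq_or_lt with rfl | hjn
    · simpa using innerRound_selects (hQ j) hr
    · simpa [hjn.ne] using ih hω' hjn

/-- The last round before `n` in which `v` was proposed was a round with two vertices, and statuses
assigned in it are valid at time `j`. -/
def IsInformative (d : ℕ) (Q : ℕ → Finset V) (v : V) (n j s : ℕ) : Prop :=
  IsLastProposal Q v n s ∧ (Q s).card = 2 ∧ j < s + d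

/-- Known statuses come from the last proposal and are correct. -/
theorem innerRun_status (hQ : ∀ j, (Q j).card ≤ 2) {n : ℕ}
    {ω : (ℕ → Option V) × (V → ℕ → Status.{u})}
    (h : ω ∈ (innerRun d Q n).support) {v : V} {j : ℕ} (hj : n ≤ j)
    (hv : ω.2 v j ≠ Status.unknown) :
    ∃ s, IsInformative d Q v n j s ∧ (ω.1 s = some v ↔ ω.2 v j = Status.selected) := by
  induction n generalizing ω with
  | zero =>
    rw [innerRun, PMF.mem_support_pure_iff] at h
    subst h
    exact absurd rfl hv
  | succ n ih =>
    obtain ⟨ω', hω', r, hr, rfl⟩ := mem_support_innerRun_succ d Q h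
    obtain ⟨hr1, hr2⟩ := innerRound_status (hQ n) hr
    by_cases hvn : v ∈ Q n
    · obtain ⟨x, hx, hx'⟩ := hr2 v hvn
      have hxj := hx j
      simp only [hxj] at hv ⊢
      by_cases hjd : j < n + d
      · rw [if_pos ⟨hj, hjd⟩] at hv ⊢
        obtain ⟨h2, hsel⟩ := hx' hv
        refine ⟨n, ⟨⟨n.lt_succ_self, hvn, fun t h1 h2 => by omega⟩, h2, hjd⟩, ?_⟩
        rwa [Function.update_self]
      · rw [if_neg fun h => hjd h.2] at hv
        obtain ⟨s, hs, -⟩ := ih hω' (Nat.le_of_succ_le hj) hv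
        have h1 := hs.1.1
        have h2 := hs.2.2
        omega
    · simp only [hr1 v hvn] at hv ⊢
      obtain ⟨s, ⟨⟨hsn, hvs, hlast⟩, h2, hjd⟩, hsel⟩ := ih hω' (Nat.le_of_succ_le hj) hv
      refine ⟨s, ⟨⟨hsn.trans n.lt_succ_self, hvs, fun t hst ht => ?_⟩, h2, hjd⟩, ?_⟩
      · rcases (Nat.lt_succ_iff.1 ht).eq_or_lt with rfl | htn
        · exact hvn
        · exact hlast t hst htn
      · rwa [Function.update_of_ne hsn.ne]

/-- Exchanging the two known statuses of `v` at time `j`, together with the selection in the round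
`s` of its last proposal, preserves the law of the run. -/
theorem mean_innerRun_swap (hQ : ∀ j, (Q j).card ≤ 2) {v k : V} (hvk : v ≠ k) {n j s : ℕ}
    (hs : IsLastProposal Q v n s)
    (hQs : Q s = {v, k}) (hsj : s < j) (hj : j < s + d)
    (f : (ℕ → Option V) × (V → ℕ → Status.{u}) → ℝ≥0∞) :
    mean (innerRun d Q n) (fun ω => f (Function.update ω.1 s (swapSelection v k (ω.1 s) (ω.2 v j)),
      flipStatus d s v ω.2)) = mean (innerRun d Q n) f := by
  induction n, Nat.succ_le_of_lt hs.1 using Nat.le_induction generalizing f with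
  | base =>
    rw [mean_innerRun_succ, mean_innerRun_succ]
    refine mean_congr fun ω _ => ?_
    simp only [Function.update_self, Function.update_idem, hQs]
    exact mean_innerRound_swap hsj hj hvk ω.2 fun r => f (Function.update ω.1 s r.1, r.2)
  | succ n hn ih =>
    have hvn : v ∉ Q n := hs.2.2 n hn n.lt_succ_self
    have hs' : IsLastProposal Q v n s :=
      ⟨hn, hs.2.1, fun t hst ht => hs.2.2 t hst (ht.trans n.lt_succ_self)⟩
    rw [mean_innerRun_succ, mean_innerRun_succ]
    refine Eq.trans (mean_congr fun ω _ => ?_) (ih hs' _)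
    rw [innerRound_flipStatus d s n (hQ n) hvn, mean_map]
    refine mean_congr fun r hr => ?_
    dsimp only
    rw [(innerRound_status (hQ n) hr).1 v hvn, Function.update_of_ne (Nat.ne_of_lt hn),
      Function.update_comm (Nat.ne_of_lt hn)]

/-- What was selected before the last proposal `s` of `v` is independent of whether the status
`selected` is assigned to `v` in round `s`, which happens with probability `1 / 8`. -/
theorem eight_mul_mean_selected (hQ : ∀ j, (Q j).card ≤ 2) {v : V} {n j s : ℕ}
    (hs : IsInformative d Q v n j s) (hsj : s < j)
    {f : (ℕ → Option V) → ℝ≥0∞}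
    (hf : ∀ a b : ℕ → Option V, (∀ t < s, a t = b t) → f a = f b) :
    8 * mean (innerRun d Q n) (fun ω => f ω.1 * ind (ω.2 v j = Status.selected)) =
      mean (innerRun d Q s) fun ω => f ω.1 := by
  obtain ⟨hs, hcard, hj⟩ := hs
  induction n, Nat.succ_le_of_lt hs.1 using Nat.le_induction with
  | base =>
    rw [mean_innerRun_succ, ← mean_mul_left]
    refine mean_congr fun ω _ => ?_
    have hfω : ∀ x, f (Function.update ω.1 s x) = f ω.1 := fun x =>
      hf _ _ fun t ht => Function.update_of_ne ht.ne _ _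
    obtain ⟨k, hvk, hQs⟩ := exists_eq_pair hcard hs.2.1
    simp only [hfω, mean_mul_left, hQs]
    rw [mul_left_comm, eight_mul_mean_pair d s hvk]
    simp [senderOutcome, receiverOutcome, assign, hsj, hj, hvk, ind, mean]
  | succ n hn ih =>
    have hvn : v ∉ Q n := hs.2.2 n hn n.lt_succ_self
    rw [← ih ⟨hn, hs.2.1, fun t hst ht => hs.2.2 t hst (ht.trans n.lt_succ_self)⟩,
      mean_innerRun_succ]
    congr 1
    refine mean_congr fun ω _ => ?_
    rw [← mean_const (innerRound d n (Q n) ω.2) (f ω.1 * ind (ω.2 v j = Status.selected))]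
    refine mean_congr fun r hr => ?_
    rw [(innerRound_status (hQ n) hr).1 v hvn]
    congr 1
    exact hf _ _ fun t ht => Function.update_of_ne (by omega) _ _

end InnerRun

/-! ### The inner algorithm is a correlated rental scheme -/

section InnerOCR

variable {V : Type u} [DecidableEq V] (d : ℕ) {Q : ℕ → Finset V}

/-- If no proposal of `v` is informative, its status is unknown. -/
theorem mean_known_eq_zero (hQ : ∀ j, (Q j).card ≤ 2) {v : V} {j : ℕ}
    (h : ∀ s, ¬IsInformative d Q v j j s) {x : Status.{u}}
    (hx : x ≠ Status.unknown) (E : (ℕ → Option V) → Prop) :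
    mean (innerRun d Q j) (fun ω => ind (E ω.1 ∧ ω.2 v j = x)) = 0 := by
  rw [← mean_const (innerRun d Q j) 0]
  refine mean_congr fun ω hω => ind_of_not fun hE => ?_
  obtain ⟨s, hs, -⟩ := innerRun_status d hQ hω le_rfl (hE.2 ▸ hx)
  exact h s hs

/-- After an informative proposal of `v` together with `k`, the probability of `notSelected` and an
event `E` is that of `selected` and the event `E` for the exchanged selection. -/
theorem mean_notSelected (hQ : ∀ j, (Q j).card ≤ 2) {v : V} {j s : ℕ}
    (hs : IsInformative d Q v j j s) :
    ∃ k, v ≠ k ∧ ∀ E : (ℕ → Option V) → Prop,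
      mean (innerRun d Q j) (fun ω => ind (E ω.1 ∧ ω.2 v j = Status.notSelected)) =
        mean (innerRun d Q j) fun ω =>
          ind (E (Function.update ω.1 s (some k)) ∧ ω.2 v j = Status.selected) := by
  obtain ⟨hs, hcard, hj⟩ := hs
  obtain ⟨k, hvk, hQs⟩ := exists_eq_pair hcard hs.2.1
  refine ⟨k, hvk, fun E => ?_⟩
  rw [← mean_innerRun_swap d hQ hvk hs hQs hs.1 hj]
  congr 1
  ext1 ω
  have hflip : flipStatus d s v ω.2 v j = (ω.2 v j).flip := if_pos ⟨rfl, hs.1, hj⟩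
  simp only [hflip]
  cases ω.2 v j <;> simp [Status.flip, swapSelection]

/-- The status of another vertex `v` at time `j` is correlated with the availability of `i` in the
favourable direction: it is influenced by whether `v` was selected at its last proposal, and `i` can
only lose availability if `v` was not selected. -/
theorem mean_notSelected_le (hQ : ∀ j, (Q j).card ≤ 2) {v i : V} (hvi : v ≠ i) (j : ℕ) :
    mean (innerRun d Q j) (fun ω => ind (Available d (rented d ω.1) i j ∧
        ω.2 v j = Status.notSelected)) ≤
      mean (innerRun d Q j) fun ω => ind (Available d (rented d ω.1) i j ∧
        ω.2 v j = Status.selected) := by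
  by_cases hex : ∃ s, IsInformative d Q v j j s
  · obtain ⟨s, hs⟩ := hex
    obtain ⟨k, -, hswap⟩ := mean_notSelected d hQ hs
    rw [hswap fun sel => Available d (rented d sel) i j]
    refine mean_mono fun ω hω => ind_mono fun ⟨hE, hsel⟩ => ⟨?_, hsel⟩
    obtain ⟨s', hs', hiff⟩ := innerRun_status d hQ hω (v := v) le_rfl (by simp [hsel])
    have hss : s' = s := WithBot.coe_injective (hs'.1.prev_eq.symm.trans hs.1.prev_eq)
    subst hss
    refine available_of_deselect d hs.1.1 hs.2.2 ?_ (fun t _ hts => ?_) hE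
    · rw [hiff.2 hsel]
      exact fun h => hvi (Option.some_injective _ h)
    · rw [Function.update_of_ne hts]
  · push Not at hex
    rw [mean_known_eq_zero d hQ hex (x := Status.notSelected) (by simp)
      fun sel => Available d (rented d sel) i j]
    exact zero_le

/-- If the last proposal `s` of `i` is informative, the status of `i` at time `j` is correlated with
its availability.  The correlation stems from the runs in which `i` was available at time `s`: then
`selected` is incompatible with availability at time `j`. -/
theorem mean_selected_add_le (hQ : ∀ j, (Q j).card ≤ 2) {i : V} {j s : ℕ}
    (hs : IsInformative d Q i j j s) :
    mean (innerRun d Q j) (fun ω => ind (Available d (rented d ω.1) i j ∧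
        ω.2 i j = Status.selected)) +
      mean (innerRun d Q j) (fun ω => ind (Available d (rented d ω.1) i s) *
        ind (ω.2 i j = Status.selected)) ≤
      mean (innerRun d Q j) fun ω => ind (Available d (rented d ω.1) i j ∧
        ω.2 i j = Status.notSelected) := by
  obtain ⟨k, hik, hswap⟩ := mean_notSelected d hQ hs
  rw [hswap fun sel => Available d (rented d sel) i j, ← mean_add]
  refine mean_mono fun ω hω => ?_
  by_cases hsel : ω.2 i j = Status.selected
  swap
  · simp [ind, hsel]
  obtain ⟨s', hs', hiff⟩ := innerRun_status d hQ hω (v := i) le_rfl (by simp [hsel])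
  have hss : s' = s := WithBot.coe_injective (hs'.1.prev_eq.symm.trans hs.1.prev_eq)
  subst hss
  have hsi := hiff.2 hsel
  have hki : some k ≠ some i := fun h => hik (Option.some_injective _ h).symm
  by_cases hav : Available d (rented d ω.1) i s'
  · -- `i` was matched at time `s'`, which still blocks it; without this match it is available.
    have h1 : ¬Available d (rented d ω.1) i j := fun h =>
      absurd (h s' hs.1.1 ((rented_eq_some_iff d ω.1 i s').2 ⟨hsi, hav⟩)) (not_le.2 hs.2.2)
    have h2 : Available d (rented d (Function.update ω.1 s' (some k))) i j := by
      intro t ht hM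
      have hsel' := ((rented_eq_some_iff d _ i t).1 hM).1
      rcases lt_trichotomy t s' with hts | rfl | hts
      · have h3 := (available_rented_congr d (a := Function.update ω.1 s' (some k)) (b := ω.1)
          (fun r hr => Function.update_of_ne hr.ne _ _) i).2 hav
        exact (h3 t hts hM).trans hs.1.1.le
      · rw [Function.update_self] at hsel'
        exact absurd hsel' hki
      · rw [Function.update_of_ne hts.ne'] at hsel'
        exact absurd ((innerRun_selects d hQ hω ht).1 i hsel') (hs.1.2.2 t hts ht)
    rw [ind_of_not fun h => h1 h.1, ind_of hav, ind_of hsel, ind_of ⟨h2, hsel⟩]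
    simp
  · rw [ind_of_not hav, zero_mul, add_zero]
    refine ind_mono fun ⟨h, _⟩ => ⟨?_, hsel⟩
    refine available_of_deselect d hs.1.1 hs.2.2 ?_ (fun t _ hts => ?_) h
    · rwa [Function.update_self]
    · rw [Function.update_of_ne hts]

theorem innerAlgorithm_availProb (i : V) (j : ℕ) : availProb d (innerAlgorithm V d) Q i j =
    (mean (innerRun d Q j) fun ω => ind (Available d (rented d ω.1) i j)).toReal := by
  rw [availProb_eq_mean, mean_innerAlgorithm_outputs]

theorem innerAlgorithm_matchProb (i : V) (j : ℕ) : matchProb d (innerAlgorithm V d) Q i j =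
    (mean (innerRun d Q j) fun ω => ind (Available d (rented d ω.1) i j) *
      mean (innerRound d j (Q j) ω.2) fun r => ind (r.1 = some i)).toReal := by
  rw [matchProb_eq_mean d _ Q i j.lt_succ_self, mean_innerAlgorithm_outputs, mean_innerRun_succ]
  congr 1
  refine mean_congr fun ω _ => ?_
  rw [← mean_mul_left]
  refine mean_congr fun r _ => ?_
  dsimp only
  rw [← ind_and, rented_eq_some_iff, Function.update_self, and_comm,
    available_rented_congr d (a := Function.update ω.1 j r.1) (b := ω.1)
      (fun t ht => Function.update_of_ne ht.ne _ _)]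

theorem innerAlgorithm_matchProb_singleton {i : V} {j : ℕ} (h : Q j = {i}) :
    matchProb d (innerAlgorithm V d) Q i j = availProb d (innerAlgorithm V d) Q i j := by
  rw [innerAlgorithm_matchProb d, innerAlgorithm_availProb d]
  congr 1
  refine mean_congr fun ω _ => ?_
  rw [h, innerRound_singleton, mean_pure, ind_of rfl, mul_one]

/-- The probability that `i` is matched in a round with two vertices, in terms of the joint
probabilities of its availability and of the recorded statuses. -/
theorem innerAlgorithm_matchProb_pair {i k : V} (hik : i ≠ k) {j : ℕ} (h : Q j = {i, k}) :
    8 * matchProb d (innerAlgorithm V d) Q i j +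
      (mean (innerRun d Q j) fun ω => ind (Available d (rented d ω.1) i j ∧
        ω.2 i j = Status.selected)).toReal +
      (mean (innerRun d Q j) fun ω => ind (Available d (rented d ω.1) i j ∧
        ω.2 k j = Status.notSelected)).toReal =
    4 * availProb d (innerAlgorithm V d) Q i j +
      (mean (innerRun d Q j) fun ω => ind (Available d (rented d ω.1) i j ∧
        ω.2 i j = Status.notSelected)).toReal +
      (mean (innerRun d Q j) fun ω => ind (Available d (rented d ω.1) i j ∧
        ω.2 k j = Status.selected)).toReal := by
  rw [innerAlgorithm_matchProb d, innerAlgorithm_availProb d]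
  have key : 8 * (mean (innerRun d Q j) fun ω => ind (Available d (rented d ω.1) i j) *
        mean (innerRound d j (Q j) ω.2) fun r => ind (r.1 = some i)) +
      (mean (innerRun d Q j) fun ω => ind (Available d (rented d ω.1) i j ∧
        ω.2 i j = Status.selected)) +
      (mean (innerRun d Q j) fun ω => ind (Available d (rented d ω.1) i j ∧
        ω.2 k j = Status.notSelected)) =
    4 * (mean (innerRun d Q j) fun ω => ind (Available d (rented d ω.1) i j)) +
      (mean (innerRun d Q j) fun ω => ind (Available d (rented d ω.1) i j ∧
        ω.2 i j = Status.notSelected)) +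
      (mean (innerRun d Q j) fun ω => ind (Available d (rented d ω.1) i j ∧
        ω.2 k j = Status.selected)) := by
    rw [← mean_mul_left, ← mean_mul_left, ← mean_add, ← mean_add, ← mean_add, ← mean_add]
    refine mean_congr fun ω _ => ?_
    simp only [ind_and, h]
    have := congrArg (ind (Available d (rented d ω.1) i j) * ·)
      (eight_mul_mean_select d j hik ω.2)
    simp only [mul_add] at this
    rw [mul_left_comm, this]
    ring
  have hm : (mean (innerRun d Q j) fun ω => ind (Available d (rented d ω.1) i j) *
      mean (innerRound d j (Q j) ω.2) fun r => ind (r.1 = some i)) ≠ ⊤ := by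
    refine ne_top_of_le_ne_top ENNReal.one_ne_top (le_trans (mean_mono fun ω _ => ?_)
      (mean_const (innerRun d Q j) 1).le)
    exact mul_le_one' (ind_le_one _) (mean_ind_le_one _ _)
  have hreal := congrArg ENNReal.toReal key
  have h8 := ENNReal.mul_ne_top (ENNReal.ofNat_ne_top (n := 8)) hm
  have h4 := ENNReal.mul_ne_top (ENNReal.ofNat_ne_top (n := 4))
    (mean_ind_ne_top (innerRun d Q j) fun ω => Available d (rented d ω.1) i j)
  rwa [ENNReal.toReal_add (ENNReal.add_ne_top.2 ⟨h8, mean_ind_ne_top _ _⟩) (mean_ind_ne_top _ _),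
    ENNReal.toReal_add h8 (mean_ind_ne_top _ _),
    ENNReal.toReal_add (ENNReal.add_ne_top.2 ⟨h4, mean_ind_ne_top _ _⟩) (mean_ind_ne_top _ _),
    ENNReal.toReal_add h4 (mean_ind_ne_top _ _), ENNReal.toReal_mul, ENNReal.toReal_mul,
    ENNReal.toReal_ofNat, ENNReal.toReal_ofNat] at hreal

theorem half_availProb_le_pair (hQ : ∀ j, (Q j).card ≤ 2) {i k : V} (hik : i ≠ k) {j : ℕ}
    (h : Q j = {i, k}) :
    availProb d (innerAlgorithm V d) Q i j / 2 ≤ matchProb d (innerAlgorithm V d) Q i j := by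
  have hpair := innerAlgorithm_matchProb_pair d hik h
  have hk := ENNReal.toReal_mono (mean_ind_ne_top _ _) (mean_notSelected_le d hQ hik.symm j)
  have hi : (mean (innerRun d Q j) fun ω => ind (Available d (rented d ω.1) i j ∧
      ω.2 i j = Status.selected)).toReal ≤ (mean (innerRun d Q j) fun ω =>
        ind (Available d (rented d ω.1) i j ∧ ω.2 i j = Status.notSelected)).toReal := by
    refine ENNReal.toReal_mono (mean_ind_ne_top _ _) ?_
    by_cases hex : ∃ s, IsInformative d Q i j j s
    · obtain ⟨s, hs⟩ := hex
      exact le_self_add.trans (mean_selected_add_le d hQ hs)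
    · push Not at hex
      rw [mean_known_eq_zero d hQ hex (x := Status.selected) (by simp)
        fun sel => Available d (rented d sel) i j]
      exact zero_le
  linarith

theorem innerAlgorithm_matchProb_ge_pair (hQ : ∀ j, (Q j).card ≤ 2) {i k : V} (hik : i ≠ k)
    {j : ℕ} (h : Q j = {i, k}) :
    availProb d (innerAlgorithm V d) Q i j / 2 +
      1 / 32 * unusedProb d (innerAlgorithm V d) Q i j ≤
        matchProb d (innerAlgorithm V d) Q i j := by
  have hhalf := half_availProb_le_pair d hQ hik h
  by_cases hz : ∀ s, IsLastProposal Q i j s → s + d ≤ j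
  · rw [unusedProb_eq_zero d _ hz]
    linarith
  push Not at hz
  obtain ⟨s, hs, hd⟩ := hz
  rw [unusedProb_of_isLastProposal d _ hs hd]
  rcases eq_singleton_or_exists_eq_pair (hQ s) hs.2.1 with h1 | ⟨l, hil, h2⟩
  · rw [innerAlgorithm_matchProb_singleton d h1]
    linarith
  · have hinf : IsInformative d Q i j j s := ⟨hs, by rw [h2, Finset.card_pair hil], hd⟩
    have hs_half := half_availProb_le_pair d hQ hil h2
    have hpair := innerAlgorithm_matchProb_pair d hik h
    have hk := ENNReal.toReal_mono (mean_ind_ne_top _ _) (mean_notSelected_le d hQ hik.symm j)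
    have hi := mean_selected_add_le d hQ hinf
    have h8 := eight_mul_mean_selected d hQ hinf hs.1
      (f := fun sel => ind (Available d (rented d sel) i s))
      fun a b hab => by rw [available_rented_congr d hab]
    simp only [← ind_and] at hi h8
    have hi' := ENNReal.toReal_mono (mean_ind_ne_top _ _) hi
    rw [ENNReal.toReal_add (mean_ind_ne_top _ _) (mean_ind_ne_top _ _)] at hi'
    have h8' := congrArg ENNReal.toReal h8
    rw [ENNReal.toReal_mul, ENNReal.toReal_ofNat, ← innerAlgorithm_availProb d] at h8'
    -- With `p`, `m` at time `s`: `8 m j ≥ 4 p j + p / 8` and `p / 8 ≥ (p - m) / 4` as `m ≥ p / 2`.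
    linarith

end InnerOCR

theorem innerAlgorithm_isOCR (V : Type u) [DecidableEq V] (d : ℕ) :
    IsOCR d (1 / 32) (innerAlgorithm V d) := by
  refine ⟨fun Q hQ n sel hsel j hj => ?_, fun Q hQ j i hi => ?_⟩
  · rw [innerAlgorithm_outputs, PMF.mem_support_map_iff] at hsel
    obtain ⟨ω, hω, rfl⟩ := hsel
    exact innerRun_selects d hQ hω hj
  · rcases eq_singleton_or_exists_eq_pair (hQ j) hi with h | ⟨k, hik, h⟩
    · rw [guarantee, h, Finset.card_singleton, if_pos rfl,
        innerAlgorithm_matchProb_singleton d h]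
    · rw [guarantee, h, Finset.card_pair hik, if_neg (by decide)]
      exact innerAlgorithm_matchProb_ge_pair d hQ hik h

end ReusableMatching

open ReusableMatching in
theorem mainTheorem1 {V : Type u} [Fintype V] [DecidableEq V] (d : ℕ) (hd : 1 ≤ d)
    (γ β₁ β₂ : ℝ) (hγ : γ = 1 / 32) (hβ₁ : β₁ = (3 + 4 * γ) / (6 + 6 * γ))
    (hβ₂ : β₂ = 1 / (2 + 2 * γ)) :
    IsOCR d γ (innerAlgorithm V d) ∧
    (∀ S : OnlineProcedure V, IsOCR d γ S →
      ∀ rule : ProposalRule V, IsPrimalDualRule d γ β₁ β₂ S rule →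
        (twoLayer d S rule).IsCompetitive d (50 / 99)) ∧
    (∃ rule : ProposalRule V, IsPrimalDualRule d γ β₁ β₂ (innerAlgorithm V d) rule ∧
      (twoLayer d (innerAlgorithm V d) rule).IsCompetitive d (50 / 99)) := by
  have h₁ : β₁ = 50 / 99 := by rw [hβ₁, hγ]; norm_num
  have h₂ : β₂ = 48 / 99 := by rw [hβ₂, hγ]; norm_num
  subst hγ h₁ h₂
  refine ⟨innerAlgorithm_isOCR V d, fun S hS rule hrule => twoLayer_isCompetitive hd hS hrule, ?_⟩
  obtain ⟨rule, hrule⟩ :=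
    exists_isPrimalDualRule d (1 / 32) (50 / 99) (48 / 99) (innerAlgorithm V d)
  exact ⟨rule, hrule, twoLayer_isCompetitive hd (innerAlgorithm_isOCR V d) hrule⟩
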